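/- Let $\mathbb K$ be a field of characteristic $0$ and let $\Lambda$ be the Hopf algebra over $\mathbb K$ of symmetric functions in $x_1,x_2,\dots$ (power series of bounded degree invariant under permuting the variables), graded by degree, with $\Delta p_n=p_n\otimes 1+1\otimes p_n$ for the power sums $p_n=\sum_i x_i^n$, $n\ge 1$. For a partition $\lambda$ let $\widetilde m_\lambda=m_\lambda\prod_{i\ge1}r_i(\lambda)!$, where $m_\lambda$ is the monomial symmetric function and $r_i(\lambda)$ is the number of parts of $\lambda$ equal to $i$. Let $\widetilde\Lambda$ be the graded Hopf algebra with the same underlying vector space, grading, coproduct and counit as $\Lambda$, but with the product $\odot$ determined by $\widetilde m_\lambda\odot\widetilde m_\mu=\widetilde m_{\lambda\sqcup\mu}$, where $\lambda\sqcup\mu$ consists of all parts of $\lambda$ together with all parts of $\mu$. For a finite simple graph $G$ with a positive integer weight $w(v)$ on each vertex $v$, let $X_G=\sum_\kappa\prod_{v}x_{\kappa(v)}^{w(v)}$, summed over all proper colorings $\kappa$ of $G$ by positive integers, and let $\overline G$ be the complement of $G$ with the same vertex weights. The weight of a set of vertices is the sum of the weights of its elements. Let $C^*,C_1,C_2,\dots$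 be pairwise disjoint sets of positive integers. Then there is a single morphism of graded Hopf algebras $\varphi:\Lambda\to\widetilde\Lambda$ with $$\varphi(p_n)=\frac{(-1)^{k-1}}{(k-1)!}\,\widetilde m_n\ \text{ for all } k\ge1,\ n\in C_k,\qquad \varphi(p_n)=0\ \text{ for all } n\in C^*,$$ such that $\varphi(X_G)=X_{\overline G}$ for every weighted graph $G$ with the following two properties: for every $k\ge1$, the vertex set of every clique of $G$ with exactly $k$ vertices has weight in $C_k$; and every set of vertices whose induced subgraph is connected but not complete has weight in $C^*$. -/

import Mathlib

noncomputable section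

namespace SymFunc

open scoped TensorProduct Nat

/-! ### Partitions -/

/-- A partition, recorded by its multiplicities: `r i` is the number of parts equal to `i`. The
union `⊔` of partitions (all parts of one together with all parts of the other) is `+`. -/
abbrev Ptn : Type := ℕ+ →₀ ℕ

/-- The partition with the single part `a` (and the empty partition if `a = 0`). -/
def part (a : ℕ) : Ptn := if h : 0 < a then Finsupp.single (a.toPNat h) 1 else 0

/-- The partition whose parts are the nonzero exponents of the monomial `x ^ d`. -/
def ptnOf (d : ℕ →₀ ℕ) : Ptn := d.sum fun _ a => part a

/-- The product of the factorials of the multiplicities of a partition. -/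
def multFact (r : Ptn) : ℕ := r.prod fun _ k => k !

lemma part_zero : part 0 = 0 := by simp [part]

lemma part_coe (a : ℕ+) : part a = Finsupp.single a 1 := by
  have h : 0 < (a : ℕ) := a.pos
  simp only [part, h, dif_pos]; rfl

lemma multFact_pos (r : Ptn) : 0 < multFact r :=
  Finset.prod_pos fun _ _ => Nat.factorial_pos _

lemma multFact_add_single (r : Ptn) (a : ℕ+) :
    multFact (r + Finsupp.single a 1) = multFact r * (r a + 1) := by
  classical
  have key : ∀ t : Ptn, ∀ S : Finset ℕ+, t.support ⊆ S → multFact t = ∏ i ∈ S, (t i)! :=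
    fun t S h => Finsupp.prod_of_support_subset t h _ (by simp)
  have h1 : r.support ⊆ insert a r.support := Finset.subset_insert _ _
  have h2 : (r + Finsupp.single a 1).support ⊆ insert a r.support := by
    intro i hi
    by_cases hia : i = a
    · simp [hia]
    · have : r i ≠ 0 := by simpa [Finsupp.single_apply, Ne.symm hia] using hi
      simp [this]
  rw [key _ _ h1, key _ _ h2, ← Finset.mul_prod_erase _ _ (Finset.mem_insert_self a _),
    ← Finset.mul_prod_erase (a := a) _ _ (Finset.mem_insert_self a _)]
  have : ∏ x ∈ (insert a r.support).erase a, ((r + Finsupp.single a 1 : Ptn) x)! =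
      ∏ x ∈ (insert a r.support).erase a, (r x)! := by
    refine Finset.prod_congr rfl fun x hx => ?_
    have : a ≠ x := (Finset.ne_of_mem_erase hx).symm
    simp [this]
  rw [this]
  simp [Nat.factorial_succ]; ring

lemma ptnOf_zero : ptnOf 0 = 0 := by simp [ptnOf]

lemma ptnOf_single (j a : ℕ) : ptnOf (Finsupp.single j a) = part a := by
  simp [ptnOf, part_zero]

lemma ptnOf_single_add (j a : ℕ) (d : ℕ →₀ ℕ) (h : d j = 0) :
    ptnOf (Finsupp.single j a + d) = part a + ptnOf d := by
  classical
  by_cases ha : a = 0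
  · simp [ha, part_zero]
  unfold ptnOf
  rw [Finsupp.sum_add_index_of_disjoint, Finsupp.sum_single_index part_zero]
  rw [Finsupp.support_single _ ha]
  simpa using h

lemma ptnOf_eq_erase (d : ℕ →₀ ℕ) (j : ℕ) : ptnOf d = part (d j) + ptnOf (d.erase j) := by
  conv_lhs => rw [← Finsupp.single_add_erase j d]
  exact ptnOf_single_add _ _ _ (by simp)

lemma ptnOf_mapDomain (σ : Equiv.Perm ℕ) (d : ℕ →₀ ℕ) : ptnOf (d.mapDomain σ) = ptnOf d :=
  Finsupp.sum_mapDomain_index_inj σ.injective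

/-- The weight (sum of the parts) of a partition, as an additive map. -/
def wt : Ptn →+ ℕ := Finsupp.liftAddHom fun i => (AddMonoidHom.mulRight (i : ℕ) : ℕ →+ ℕ)

lemma wt_single (a : ℕ+) (k : ℕ) : wt (Finsupp.single a k) = k * a := by simp [wt]

lemma wt_part (a : ℕ) : wt (part a) = a := by
  unfold part; split_ifs with h
  · rw [wt_single, one_mul]; rfl
  · simp; omega

lemma wt_ptnOf (d : ℕ →₀ ℕ) : wt (ptnOf d) = d.degree := by
  simp [ptnOf, Finsupp.sum, wt_part, Finsupp.degree_apply]

lemma le_wt (r : Ptn) (i : ℕ+) (h : r i ≠ 0) : (i : ℕ) ≤ wt r ∧ r i ≤ wt r := by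
  have h1 : r i * i ≤ wt r := by
    conv_rhs => rw [← Finsupp.single_add_erase i r, map_add, wt_single]
    exact Nat.le_add_right _ _
  have := i.pos
  exact ⟨(Nat.le_mul_of_pos_left _ (Nat.pos_of_ne_zero h)).trans h1,
    (Nat.le_mul_of_pos_right _ this).trans h1⟩

lemma finite_wt_le (N : ℕ) : {r : Ptn | wt r ≤ N}.Finite := by
  classical
  refine (Set.finite_Iic (∑ i ∈ Finset.range N, Finsupp.single (i.succPNat) N : Ptn)).subset ?_
  intro r hr i
  by_cases h : r i = 0
  · simp [h]
  obtain ⟨h1, h2⟩ := le_wt r i h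
  have hr' : wt r ≤ N := hr
  rw [Finsupp.finsetSum_apply]
  have hm : (i.natPred) ∈ Finset.range N := by
    have := PNat.natPred_add_one i
    simp; omega
  refine le_trans ?_ (Finset.single_le_sum (fun _ _ => Nat.zero_le _) hm)
  simp; omega

lemma exists_ptnOf (r : Ptn) : ∃ d, ptnOf d = r := by
  classical
  induction r using Finsupp.induction_linear with
  | zero => exact ⟨0, ptnOf_zero⟩
  | add f g hf hg =>
    clear hf
    induction f using Finsupp.induction_linear generalizing g with
    | zero => simpa using hg
    | add f f' h h' => rw [add_assoc]; exact h _ (h' _ hg)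
    | single a k =>
      induction k with
      | zero => simpa using hg
      | succ k ih =>
        obtain ⟨d, hd⟩ := ih
        obtain ⟨j, hj⟩ := Infinite.exists_notMem_finset d.support
        refine ⟨Finsupp.single j (a : ℕ) + d, ?_⟩
        rw [ptnOf_single_add _ _ _ (by simpa using hj), hd, part_coe,
          Nat.add_comm k 1, Finsupp.single_add, add_assoc]
  | single a k =>
    induction k with
    | zero => exact ⟨0, by simp [ptnOf_zero]⟩
    | succ k ih =>
      obtain ⟨d, hd⟩ := ih
      obtain ⟨j, hj⟩ := Infinite.exists_notMem_finset d.support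
      refine ⟨Finsupp.single j (a : ℕ) + d, ?_⟩
      rw [ptnOf_single_add _ _ _ (by simpa using hj), hd, part_coe,
        Nat.add_comm k 1, Finsupp.single_add]

lemma exists_eq_of_mem (d : ℕ →₀ ℕ) (b : ℕ+) (h : ptnOf d b ≠ 0) : ∃ j, d j = b := by
  by_contra! hc
  apply h
  rw [ptnOf, Finsupp.sum, Finsupp.finsetSum_apply]
  refine Finset.sum_eq_zero fun j _ => ?_
  unfold part; split_ifs with h0
  · rw [Finsupp.single_apply, if_neg]
    intro hb; exact hc j (by rw [← hb]; rfl)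
  · rfl

lemma exists_perm (d d' : ℕ →₀ ℕ) (h : ptnOf d = ptnOf d') :
    ∃ σ : Equiv.Perm ℕ, d.mapDomain σ = d' := by
  classical
  induction d using Finsupp.induction generalizing d' with
  | zero =>
    refine ⟨1, ?_⟩
    have := congrArg wt h
    rw [wt_ptnOf, wt_ptnOf, map_zero, eq_comm, Finsupp.degree_eq_zero_iff] at this
    simp [this]
  | single_add a b f ha hb ih =>
    have hfa : f a = 0 := by simpa using ha
    rw [ptnOf_single_add _ _ _ hfa] at h
    obtain ⟨j, hj⟩ := exists_eq_of_mem d' (b.toPNat (Nat.pos_of_ne_zero hb)) (by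
      rw [← h]
      simp [part, Nat.pos_of_ne_zero hb])
    have hj' : d' j = b := hj
    rw [ptnOf_eq_erase d' j, hj'] at h
    obtain ⟨σ, hσ⟩ := ih _ (add_left_cancel h)
    refine ⟨σ.trans (Equiv.swap (σ a) j), ?_⟩
    rw [Finsupp.mapDomain_add, Finsupp.mapDomain_single]
    have e1 : (σ.trans (Equiv.swap (σ a) j)) a = j := by simp
    have e2 : Finsupp.mapDomain (σ.trans (Equiv.swap (σ a) j)) f = d'.erase j := by
      rw [Equiv.coe_trans, Finsupp.mapDomain_comp, hσ]
      have hz : (d'.erase j) (σ a) = 0 := by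
        rw [← hσ, Finsupp.mapDomain_apply σ.injective, hfa]
      have : ∀ g : ℕ →₀ ℕ, g (σ a) = 0 → g j = 0 →
          Finsupp.mapDomain (Equiv.swap (σ a) j) g = g := by
        intro g h1 h2
        ext x
        rw [← Finsupp.equivMapDomain_eq_mapDomain, Finsupp.equivMapDomain_apply, Equiv.symm_swap]
        by_cases hx : x = σ a
        · subst hx; simp [h1, h2]
        by_cases hx' : x = j
        · subst hx'; simp [h1, h2]
        rw [Equiv.swap_apply_of_ne_of_ne hx hx']
      exact this _ hz (by simp)
    rw [e1, e2, ← hj']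
    exact Finsupp.single_add_erase j d'

/-! ### The ring of symmetric functions -/

section
variable (K : Type*) [Field K]

/-- The algebra `Λ` of symmetric functions over `K`: the formal power series in the variables
`x₀, x₁, x₂, …` that have bounded degree and are invariant under all permutations of the
variables. -/
def symAlg : Subalgebra K (MvPowerSeries ℕ K) where
  carrier := {f | (∀ (σ : Equiv.Perm ℕ) (d : ℕ →₀ ℕ),
      MvPowerSeries.coeff (d.mapDomain σ) f = MvPowerSeries.coeff d f) ∧
    ∃ N : ℕ, ∀ d, MvPowerSeries.coeff d f ≠ 0 → d.degree ≤ N}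
  mul_mem' := by
    classical
    rintro f g ⟨hf, N, hN⟩ ⟨hg, M, hM⟩
    refine ⟨fun σ d => ?_, N + M, fun d hd => ?_⟩
    · rw [MvPowerSeries.coeff_mul, MvPowerSeries.coeff_mul]
      symm
      refine Finset.sum_nbij' (fun p => (p.1.mapDomain σ, p.2.mapDomain σ))
        (fun p => (p.1.mapDomain σ.symm, p.2.mapDomain σ.symm)) ?_ ?_ ?_ ?_ ?_
      · intro p hp
        rw [Finset.HasAntidiagonal.mem_antidiagonal] at hp ⊢
        rw [← hp, Finsupp.mapDomain_add]
      · intro p hp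
        rw [Finset.HasAntidiagonal.mem_antidiagonal] at hp ⊢
        rw [← Finsupp.mapDomain_add, hp, ← Finsupp.mapDomain_comp]
        simp
      · intro p _; simp [← Finsupp.mapDomain_comp]
      · intro p _; simp [← Finsupp.mapDomain_comp]
      · intro p _; simp only [hf, hg]
    · rw [MvPowerSeries.coeff_mul] at hd
      obtain ⟨p, hp, hne⟩ := Finset.exists_ne_zero_of_sum_ne_zero hd
      rw [Finset.HasAntidiagonal.mem_antidiagonal] at hp
      rw [← hp, map_add]
      exact add_le_add (hN _ (left_ne_zero_of_mul hne)) (hM _ (right_ne_zero_of_mul hne))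
  add_mem' := by
    rintro f g ⟨hf, N, hN⟩ ⟨hg, M, hM⟩
    refine ⟨fun σ d => by simp [hf, hg], max N M, fun d hd => ?_⟩
    by_contra! hlt
    apply hd
    have h1 : MvPowerSeries.coeff d f = 0 := by
      by_contra h; exact absurd (hN d h) (by omega)
    have h2 : MvPowerSeries.coeff d g = 0 := by
      by_contra h; exact absurd (hM d h) (by omega)
    simp [h1, h2]
  algebraMap_mem' := by
    classical
    intro c
    have h : algebraMap K (MvPowerSeries ℕ K) c = MvPowerSeries.C c := rfl
    refine ⟨fun σ d => ?_, 0, fun d hd => ?_⟩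
    · rw [h, MvPowerSeries.coeff_C, MvPowerSeries.coeff_C]
      have : d.mapDomain σ = 0 ↔ d = 0 := by
        rw [← Finsupp.degree_eq_zero_iff, Finsupp.degree_mapDomain, Finsupp.degree_eq_zero_iff]
      simp [this]
    · rw [h, MvPowerSeries.coeff_C] at hd
      have : d = 0 := by by_contra h; simp [h] at hd
      simp [this]

/-- The ring of symmetric functions `Λ`, as a type. -/
abbrev Lam : Type _ := symAlg K

/-- The part of `Λ` that is homogeneous of degree `n`. -/
def homog (n : ℕ) : Submodule K (Lam K) where
  carrier := {f | ∀ d, MvPowerSeries.coeff d (f : MvPowerSeries ℕ K) ≠ 0 → d.degree = n}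
  zero_mem' := by intro d hd; simp at hd
  add_mem' := by
    intro f g hf hg d hd
    by_cases h : MvPowerSeries.coeff d (f : MvPowerSeries ℕ K) = 0
    · exact hg d (by simpa [h] using hd)
    · exact hf d h
  smul_mem' := by
    intro c f hf d hd
    exact hf d (by intro h; simp [h] at hd)

variable {K}

lemma Lam.coeff_eq (f : Lam K) {d d' : ℕ →₀ ℕ} (h : ptnOf d = ptnOf d') :
    MvPowerSeries.coeff d (f : MvPowerSeries ℕ K) = MvPowerSeries.coeff d' (f : _) := by
  obtain ⟨σ, hσ⟩ := exists_perm d d' h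
  rw [← hσ]; exact (f.2.1 σ d).symm

/-- A function of partitions with finite support gives a symmetric function, by using it as the
coefficient function. -/
lemma mem_symAlg_of_ptn (c : Ptn → K) (N : ℕ) (hc : ∀ r, c r ≠ 0 → wt r ≤ N) :
    (fun d => c (ptnOf d) : MvPowerSeries ℕ K) ∈ symAlg K := by
  refine ⟨fun σ d => ?_, N, fun d hd => ?_⟩
  · change c _ = c _
    rw [ptnOf_mapDomain]
  · rw [← wt_ptnOf]; exact hc _ hd

/-- The monomial symmetric function `m_r`: the sum of all distinct monomials whose nonzero
exponents are the parts of `r`. -/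
def mono (r : Ptn) : Lam K :=
  ⟨fun d => if ptnOf d = r then 1 else 0,
    mem_symAlg_of_ptn (fun s => if s = r then 1 else 0) (wt r) (by
      intro s hs; by_cases h : s = r
      · rw [h]
      · simp [h] at hs)⟩

/-- The augmented monomial symmetric function `m̃_r = (∏ i, (r i)!) • m_r`. -/
def augMono (r : Ptn) : Lam K := (multFact r : K) • mono r

open Classical in
/-- The power sum `p_n = x₀ ^ n + x₁ ^ n + ⋯` for `n ≥ 1`, as the power series whose coefficient
at a monomial is `1` if the monomial is some `x_j ^ n`, and `0` otherwise. -/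
def psum (n : ℕ+) : Lam K :=
  ⟨fun d => if ∃ j : ℕ, d = Finsupp.single j (n : ℕ) then 1 else 0, by
    refine ⟨fun σ d => ?_, n, fun d hd => ?_⟩
    · change (if _ then _ else _) = (if _ then _ else _)
      refine if_congr ⟨?_, ?_⟩ rfl rfl
      · rintro ⟨j, hj⟩
        refine ⟨σ.symm j, ?_⟩
        apply Finsupp.mapDomain_injective σ.injective
        rw [hj, Finsupp.mapDomain_single, Equiv.apply_symm_apply]
      · rintro ⟨j, hj⟩
        exact ⟨σ j, by rw [hj, Finsupp.mapDomain_single]⟩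
    · by_cases h : ∃ j : ℕ, d = Finsupp.single j (n : ℕ)
      · obtain ⟨j, rfl⟩ := h
        simp
      · exact absurd (if_neg h) hd⟩

end

section
variable {K : Type*} [Field K]

/-! ### The augmented monomial basis -/

/-- Polynomials in formal generators indexed by the positive integers; monomials are partitions. -/
abbrev Poly (K : Type*) [Field K] : Type _ := MvPolynomial ℕ+ K

lemma exists_wt_bound (x : Poly K) : ∃ N, ∀ r, MvPolynomial.coeff r x ≠ 0 → wt r ≤ N := by
  classical
  refine ⟨x.support.sup wt, fun r hr => ?_⟩
  exact Finset.le_sup (f := fun r => wt r) (MvPolynomial.mem_support_iff.2 hr)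

/-- The linear map from polynomials to `Λ` that sends the monomial of a partition to the augmented
monomial symmetric function of that partition. -/
def augLin (K : Type*) [Field K] : Poly K →ₗ[K] Lam K where
  toFun x := ⟨fun d => MvPolynomial.coeff (ptnOf d) x * (multFact (ptnOf d) : K), by
    obtain ⟨N, hN⟩ := exists_wt_bound x
    exact mem_symAlg_of_ptn (fun r => MvPolynomial.coeff r x * (multFact r : K)) N
      fun r hr => hN r (left_ne_zero_of_mul hr)⟩
  map_add' x y := by
    apply Subtype.ext
    funext d
    change MvPolynomial.coeff _ (x + y) * _ =
      MvPolynomial.coeff _ x * _ + MvPolynomial.coeff _ y * _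
    rw [MvPolynomial.coeff_add, add_mul]
  map_smul' c x := by
    apply Subtype.ext
    funext d
    change MvPolynomial.coeff _ (c • x) * _ = c • (MvPolynomial.coeff _ x * _)
    rw [MvPolynomial.coeff_smul, smul_eq_mul, smul_eq_mul, mul_assoc]

lemma coeff_augLin (x : Poly K) (d : ℕ →₀ ℕ) :
    MvPowerSeries.coeff d (augLin K x : MvPowerSeries ℕ K) =
      MvPolynomial.coeff (ptnOf d) x * (multFact (ptnOf d) : K) := rfl

lemma coeff_mono (r : Ptn) (d : ℕ →₀ ℕ) :
    MvPowerSeries.coeff d (mono r : Lam K).1 = if ptnOf d = r then 1 else 0 := rfl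

open Classical in
lemma coeff_psum (n : ℕ+) (d : ℕ →₀ ℕ) :
    MvPowerSeries.coeff d (psum n : Lam K).1 =
      if ∃ j : ℕ, d = Finsupp.single j (n : ℕ) then 1 else 0 := rfl

lemma augLin_monomial (r : Ptn) : augLin K (MvPolynomial.monomial r 1) = augMono r := by
  classical
  apply Subtype.ext
  ext d
  rw [coeff_augLin, MvPolynomial.coeff_monomial]
  change _ = MvPowerSeries.coeff d ((multFact r : K) • (mono r : Lam K).1)
  rw [map_smul, coeff_mono]
  by_cases h : ptnOf d = r
  · simp [h]
  · simp [h, Ne.symm h]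

lemma ptnOf_eq_zero (d : ℕ →₀ ℕ) : ptnOf d = 0 ↔ d = 0 := by
  refine ⟨fun h => ?_, fun h => by rw [h, ptnOf_zero]⟩
  have := congrArg wt h
  rwa [wt_ptnOf, map_zero, Finsupp.degree_eq_zero_iff] at this

lemma augLin_one : augLin K 1 = 1 := by
  classical
  apply Subtype.ext
  ext d
  rw [coeff_augLin, MvPolynomial.coeff_one]
  change _ = MvPowerSeries.coeff d 1
  rw [MvPowerSeries.coeff_one]
  by_cases h : d = 0
  · simp [h, ptnOf_zero, multFact]
  · simp [h, Ne.symm (mt (ptnOf_eq_zero d).1 h)]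

lemma augLin_bijective [CharZero K] : Function.Bijective (augLin K) := by
  constructor
  · intro x y h
    ext r
    obtain ⟨d, rfl⟩ := exists_ptnOf r
    have := congrArg (fun f : Lam K => MvPowerSeries.coeff d (f : MvPowerSeries ℕ K)) h
    simp only [coeff_augLin] at this
    exact mul_right_cancel₀ (by exact_mod_cast (multFact_pos _).ne') this
  · intro f
    choose e he using exists_ptnOf
    obtain ⟨N, hN⟩ := f.2.2
    have hfin : (Function.support fun r : Ptn =>
        MvPowerSeries.coeff (e r) (f : MvPowerSeries ℕ K) / (multFact r : K)).Finite := by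
      refine (finite_wt_le N).subset fun r hr => ?_
      have := hN (e r) (fun h => hr (by simp [h]))
      rwa [← wt_ptnOf, he] at this
    refine ⟨AddMonoidAlgebra.ofCoeff (Finsupp.ofSupportFinite _ hfin), ?_⟩
    apply Subtype.ext
    ext d
    rw [coeff_augLin]
    change MvPowerSeries.coeff (e (ptnOf d)) (f : MvPowerSeries ℕ K) / (multFact (ptnOf d) : K) *
      (multFact (ptnOf d) : K) = _
    rw [div_mul_cancel₀ _ (by exact_mod_cast (multFact_pos _).ne')]
    exact f.coeff_eq (he _)

/-- The augmented monomial symmetric functions form a basis of `Λ`. -/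
def augEquiv (K : Type*) [Field K] [CharZero K] : Poly K ≃ₗ[K] Lam K :=
  LinearEquiv.ofBijective (augLin K) augLin_bijective

/-! ### Products of a power sum and an augmented monomial symmetric function -/

/-- The operator `X_n + ∑ i, X_{i+n} ∂/∂X_i` on polynomials. -/
def raise (n : ℕ+) : Poly K →ₗ[K] Poly K :=
  LinearMap.mulLeft K (MvPolynomial.X n) +
    (MvPolynomial.mkDerivation K fun i : ℕ+ => (MvPolynomial.X (i + n) : Poly K)).toLinearMap

lemma raise_apply (n : ℕ+) (x : Poly K) : raise n x = MvPolynomial.X n * x +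
    MvPolynomial.mkDerivation K (fun i : ℕ+ => (MvPolynomial.X (i + n) : Poly K)) x := rfl

lemma coeff_psum_mul (n : ℕ+) (g : MvPowerSeries ℕ K) (d : ℕ →₀ ℕ) :
    MvPowerSeries.coeff d ((psum n : Lam K).1 * g) =
      ∑ j ∈ d.support with (n : ℕ) ≤ d j,
        MvPowerSeries.coeff (d - Finsupp.single j (n : ℕ)) g := by
  classical
  rw [MvPowerSeries.coeff_mul]
  symm
  have hn := n.pos
  refine Finset.sum_of_injOn (fun j => (Finsupp.single j (n : ℕ), d - Finsupp.single j (n : ℕ)))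
    ?_ ?_ ?_ ?_
  · intro j _ j' _ h
    exact Finsupp.single_left_injective hn.ne' (congrArg Prod.fst h)
  · intro j hj
    simp only [Finset.coe_filter, Set.mem_ofPred_eq] at hj
    simp only [Finset.mem_coe, Finset.HasAntidiagonal.mem_antidiagonal]
    exact add_tsub_cancel_of_le (by simpa using hj.2)
  · rintro ⟨a, b⟩ hab hni
    rw [Finset.HasAntidiagonal.mem_antidiagonal] at hab
    simp only at hab
    rw [coeff_psum, if_neg, zero_mul]
    rintro ⟨j, rfl⟩
    apply hni
    refine ⟨j, ?_, ?_⟩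
    · simp only [Finset.coe_filter, Set.mem_ofPred_eq, ← hab]
      simp
    · simp [← hab]
  · intro j _
    rw [coeff_psum, if_pos ⟨j, rfl⟩, one_mul]

lemma sum_parts (d : ℕ →₀ ℕ) (H : ℕ → K) :
    ∑ j ∈ d.support, H (d j) = (ptnOf d).sum fun a k => (k : K) * H a := by
  let L : Ptn →+ K := Finsupp.liftAddHom fun a : ℕ+ =>
    (AddMonoidHom.mulRight (H a)).comp (Nat.castAddMonoidHom K)
  have hL : ∀ r : Ptn, L r = r.sum fun a k => (k : K) * H a := fun r => rfl
  rw [← hL, ptnOf, Finsupp.sum, map_sum]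
  refine Finset.sum_congr rfl fun j hj => ?_
  have h : 0 < d j := Nat.pos_of_ne_zero (by simpa using hj)
  rw [part, dif_pos h, hL, Finsupp.sum_single_index (by simp)]
  simp; rfl

lemma ptnOf_tsub (d : ℕ →₀ ℕ) (j n : ℕ) (h : n ≤ d j) :
    ptnOf (d - Finsupp.single j n) + part (d j) = ptnOf d + part (d j - n) := by
  classical
  have e : d - Finsupp.single j n = Finsupp.single j (d j - n) + d.erase j := by
    ext x
    by_cases hx : x = j
    · subst hx; simp
    · simp [Ne.symm hx, Finsupp.erase_ne hx]
  rw [e, ptnOf_single_add _ _ _ (by simp), ptnOf_eq_erase d j]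
  abel

lemma psum_mul_augMono [CharZero K] (n : ℕ+) (r : Ptn) :
    psum n * augMono r = augLin K (raise n (MvPolynomial.monomial r 1)) := by
  classical
  apply Subtype.ext
  ext d
  change MvPowerSeries.coeff d ((psum n : Lam K).1 * (augMono r : Lam K).1) = _
  rw [coeff_psum_mul, coeff_augLin, raise_apply, MvPolynomial.coeff_add,
    MvPolynomial.mkDerivation_monomial, ← augLin_monomial, one_smul, Finsupp.sum,
    MvPolynomial.coeff_sum]
  simp only [coeff_augLin, MvPolynomial.coeff_monomial]
  set s := ptnOf d with hs
  -- the left side as a sum over the distinct parts of `s`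
  have hleft : ∀ j ∈ d.support.filter fun j => (n : ℕ) ≤ d j,
      (if r = ptnOf (d - Finsupp.single j (n : ℕ)) then (1 : K) else 0) *
        (multFact (ptnOf (d - Finsupp.single j (n : ℕ))) : K) =
      if r + part (d j) = s + part (d j - n) then (multFact r : K) else 0 := by
    intro j hj
    have h2 := ptnOf_tsub d j n (Finset.mem_filter.1 hj).2
    by_cases h : r = ptnOf (d - Finsupp.single j (n : ℕ))
    · rw [if_pos h, one_mul, if_pos (by rw [h, h2]), ← h]
    · rw [if_neg h, zero_mul, if_neg]
      intro h3
      rw [← h2] at h3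
      exact h (add_right_cancel h3)
  rw [Finset.sum_congr rfl hleft, Finset.sum_filter,
    sum_parts d (fun a => if (n : ℕ) ≤ a then
      (if r + part a = s + part (a - n) then (multFact r : K) else 0) else 0), ← hs]
  -- the right side
  have hX : MvPolynomial.coeff s ((MvPolynomial.X n : Poly K) * MvPolynomial.monomial r 1) =
      if r + Finsupp.single n 1 = s then 1 else 0 := by
    rw [MvPolynomial.X, MvPolynomial.monomial_mul, MvPolynomial.coeff_monomial, mul_one, add_comm]
  have hD : ∀ i : ℕ+, MvPolynomial.coeff s
      (MvPolynomial.monomial (r - Finsupp.single i 1) ((r i : ℕ) : K) •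
        (MvPolynomial.X (i + n) : Poly K)) =
      if r + Finsupp.single (i + n) 1 = s + Finsupp.single i 1 then (r i : K) else 0 := by
    intro i
    rw [smul_eq_mul, MvPolynomial.X, MvPolynomial.monomial_mul, MvPolynomial.coeff_monomial, mul_one]
    by_cases h0 : r i = 0
    · simp [h0]
    refine if_congr ?_ rfl rfl
    have : r = (r - Finsupp.single i 1) + Finsupp.single i 1 := by
      rw [tsub_add_cancel_of_le]
      simpa using Nat.one_le_iff_ne_zero.2 h0
    conv_rhs => rw [this, add_right_comm]
    exact ⟨fun h => by rw [h], fun h => add_right_cancel h⟩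
  rw [hX, add_mul, Finset.sum_mul]
  simp only [hD]
  rw [Finsupp.sum]
  -- split off the part equal to `n`
  rw [← Finset.sum_filter_add_sum_filter_not s.support (fun a => a = n)]
  congr 1
  · by_cases h : r + Finsupp.single n 1 = s
    · have hn : n ∈ s.support := by rw [← h]; simp
      rw [Finset.filter_eq' s.support n, if_pos hn, Finset.sum_singleton]
      simp only [le_refl, if_true, tsub_self, part_zero, add_zero, part_coe, h]
      rw [← h, multFact_add_single]
      simp; ring
    · rw [if_neg h, zero_mul]
      refine Finset.sum_eq_zero fun a ha => ?_
      have : a = n := (Finset.mem_filter.1 ha).2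
      subst this
      simp [part_zero, part_coe, h]
  · symm
    refine Finset.sum_bij_ne_zero (fun i _ _ => i + n) ?_ ?_ ?_ ?_
    · intro i hi hne
      have hc : r + Finsupp.single (i + n) 1 = s + Finsupp.single i 1 := by
        by_contra h; simp [h] at hne
      have hin : i + n ≠ i := by
        intro h
        have := congrArg PNat.val h
        have := n.pos
        simp at *
      have hs1 := DFunLike.congr_fun hc (i + n)
      simp [hin.symm] at hs1
      rw [Finset.mem_filter, Finsupp.mem_support_iff]
      refine ⟨by omega, ?_⟩
      intro h
      have := congrArg PNat.val h
      have := i.pos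
      simp at *
    · intro i _ _ i' _ _ h
      exact add_right_cancel h
    · intro a ha hne
      rw [Finset.mem_filter] at ha
      have hle : (n : ℕ) ≤ a := by
        by_contra h; simp [h] at hne
      have hlt : n < a := lt_of_le_of_ne (by exact_mod_cast hle) (Ne.symm ha.2)
      have hadd : (a - n) + n = a := by rw [add_comm]; exact PNat.add_sub_of_lt hlt
      have hsub : (a : ℕ) - n = ((a - n : ℕ+) : ℕ) := by
        have := congrArg PNat.val hadd
        simp only [PNat.add_coe] at this
        have h' : ((a - n : ℕ+) : ℕ) + n = a := this
        omega
      have hc : r + Finsupp.single a 1 = s + Finsupp.single (a - n) 1 := by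
        by_contra h
        rw [if_pos hle, hsub, part_coe, part_coe, if_neg h] at hne
        simp at hne
      have han : a ≠ a - n := by
        intro h
        have := congrArg PNat.val hadd
        rw [← h] at this
        have := n.pos
        simp at *
      have hs1 := DFunLike.congr_fun hc (a - n)
      simp [han] at hs1
      refine ⟨a - n, ?_, ?_, hadd⟩
      · rw [Finsupp.mem_support_iff]; omega
      · rw [hadd, if_pos hc]
        refine mul_ne_zero ?_ (by exact_mod_cast (multFact_pos _).ne')
        exact_mod_cast (by omega : r (a - n) ≠ 0)
    · intro i hi hne
      have hc : r + Finsupp.single (i + n) 1 = s + Finsupp.single i 1 := by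
        by_contra h; simp [h] at hne
      have hin : i + n ≠ i := by
        intro h
        have := congrArg PNat.val h
        have := n.pos
        simp at *
      have e1 := DFunLike.congr_fun hc (i + n)
      have e2 := DFunLike.congr_fun hc i
      simp [hin.symm, hin] at e1 e2
      have hf := congrArg multFact hc
      rw [multFact_add_single, multFact_add_single] at hf
      have hle : (n : ℕ) ≤ ((i + n : ℕ+) : ℕ) := by simp
      have hsub : ((i + n : ℕ+) : ℕ) - n = i := by simp
      rw [if_pos hc, if_pos hle, hsub, part_coe, part_coe, if_pos hc, e2, ← e1]
      have : ((multFact r * (r (i + n) + 1) : ℕ) : K) = ((multFact s * (s i + 1) : ℕ) : K) := by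
        rw [hf]
      push_cast at this ⊢
      linear_combination -this

end

section
variable {K : Type*} [Field K]

lemma psum_mul_augLin [CharZero K] (n : ℕ+) (x : Poly K) :
    psum n * augLin K x = augLin K (raise n x) := by
  induction x using MvPolynomial.monomial_add_induction_on with
  | C a =>
    have h := psum_mul_augMono (K := K) n 0
    rw [← augLin_monomial] at h
    have e : (MvPolynomial.C a : Poly K) = a • MvPolynomial.monomial 0 1 := by
      rw [MvPolynomial.smul_monomial, smul_eq_mul, mul_one]; rfl
    rw [e, map_smul, map_smul, map_smul, mul_smul_comm, h]
  | monomial_add r c f _ _ ih =>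
    have h := psum_mul_augMono (K := K) n r
    rw [← augLin_monomial] at h
    have e : (MvPolynomial.monomial r c : Poly K) = c • MvPolynomial.monomial r 1 := by
      rw [MvPolynomial.smul_monomial, smul_eq_mul, mul_one]
    rw [map_add, mul_add, ih, e, map_smul, map_add, map_add, map_smul, map_smul, mul_smul_comm, h]

/-! ### The power sums are algebraically independent generators -/

/-- Polynomials all of whose monomials have fewer than `k` factors. -/
def filt (K : Type*) [Field K] (k : ℕ) : Submodule K (Poly K) :=
  Submodule.span K ((fun s : Ptn => MvPolynomial.monomial s (1 : K)) '' {s | s.degree < k})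

lemma monomial_mem_filt {s : Ptn} {k : ℕ} (h : s.degree < k) :
    MvPolynomial.monomial s (1 : K) ∈ filt K k :=
  Submodule.subset_span ⟨s, h, rfl⟩

lemma filt_mono {k l : ℕ} (h : k ≤ l) : filt K k ≤ filt K l :=
  Submodule.span_mono (Set.image_mono fun _ (hs : _ < k) => lt_of_lt_of_le hs h)

lemma filt_zero : filt K 0 = ⊥ := by simp [filt]

lemma exists_mem_filt (x : Poly K) : ∃ k, x ∈ filt K k := by
  induction x using MvPolynomial.monomial_add_induction_on with
  | C a =>
    refine ⟨1, ?_⟩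
    have e : (MvPolynomial.C a : Poly K) = a • MvPolynomial.monomial 0 1 := by
      rw [MvPolynomial.smul_monomial, smul_eq_mul, mul_one]; rfl
    rw [e]
    exact Submodule.smul_mem _ _ (monomial_mem_filt (by simp))
  | monomial_add r c f _ _ ih =>
    obtain ⟨k, hk⟩ := ih
    refine ⟨max k (r.degree + 1), add_mem ?_ (filt_mono (le_max_left _ _) hk)⟩
    have e : (MvPolynomial.monomial r c : Poly K) = c • MvPolynomial.monomial r 1 := by
      rw [MvPolynomial.smul_monomial, smul_eq_mul, mul_one]
    rw [e]
    exact Submodule.smul_mem _ _ (monomial_mem_filt (lt_of_lt_of_le (Nat.lt_succ_self _)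
      (le_max_right _ _)))

lemma X_mul_mem_filt (n : ℕ+) {k : ℕ} {x : Poly K} (hx : x ∈ filt K k) :
    MvPolynomial.X n * x ∈ filt K (k + 1) := by
  have : filt K k ≤ (filt K (k + 1)).comap (LinearMap.mulLeft K (MvPolynomial.X n)) := by
    refine Submodule.span_le.2 ?_
    rintro _ ⟨s, hs, rfl⟩
    have hs' : s.degree < k := hs
    simp only [SetLike.mem_coe, Submodule.mem_comap, LinearMap.mulLeft_apply]
    rw [MvPolynomial.X, MvPolynomial.monomial_mul, mul_one]
    refine monomial_mem_filt ?_
    rw [map_add, Finsupp.degree_single]; omega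
  exact this hx

lemma derivation_mem_filt (n : ℕ+) {k : ℕ} {x : Poly K} (hx : x ∈ filt K k) :
    MvPolynomial.mkDerivation K (fun i : ℕ+ => (MvPolynomial.X (i + n) : Poly K)) x ∈
      filt K k := by
  have : filt K k ≤ (filt K k).comap (MvPolynomial.mkDerivation K
      (fun i : ℕ+ => (MvPolynomial.X (i + n) : Poly K))).toLinearMap := by
    refine Submodule.span_le.2 ?_
    rintro _ ⟨s, hs, rfl⟩
    have hs' : s.degree < k := hs
    change MvPolynomial.mkDerivation K _ _ ∈ filt K k
    rw [MvPolynomial.mkDerivation_monomial, one_smul]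
    refine Submodule.sum_mem _ fun i hi => ?_
    have h1 : (MvPolynomial.monomial (s - Finsupp.single i 1) ((s i : ℕ) : K) •
        (MvPolynomial.X (i + n) : Poly K)) = (s i : K) •
        MvPolynomial.monomial (s - Finsupp.single i 1 + Finsupp.single (i + n) 1) 1 := by
      rw [smul_eq_mul, MvPolynomial.X, MvPolynomial.monomial_mul, MvPolynomial.smul_monomial,
        smul_eq_mul]
    change MvPolynomial.monomial (s - Finsupp.single i 1) ((s i : ℕ) : K) •
        (MvPolynomial.X (i + n) : Poly K) ∈ _
    rw [h1]
    refine Submodule.smul_mem _ _ (monomial_mem_filt ?_)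
    have h2 : s - Finsupp.single i 1 + Finsupp.single i 1 = s :=
      tsub_add_cancel_of_le (by
        simpa using Nat.one_le_iff_ne_zero.2 (Finsupp.mem_support_iff.1 hi))
    have h3 := congrArg Finsupp.degree h2
    rw [map_add, Finsupp.degree_single] at h3 ⊢
    omega
  exact this hx

variable (K) in
/-- The algebra map from polynomials to `Λ` sending each generator to a power sum. -/
def psumHom : Poly K →ₐ[K] Lam K := MvPolynomial.aeval psum

lemma psumHom_X (n : ℕ+) : psumHom K (MvPolynomial.X n) = psum n := by simp [psumHom]

variable (K) in
/-- The counit of `Λ`: the constant term. -/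
def constTerm : Lam K →ₐ[K] K :=
  { (MvPowerSeries.constantCoeff (σ := ℕ) (R := K)).comp (symAlg K).val.toRingHom with
    commutes' := fun c => by
      change MvPowerSeries.constantCoeff (algebraMap K (MvPowerSeries ℕ K) c) = c
      exact MvPowerSeries.constantCoeff_C c }

@[simp] lemma constTerm_psum (n : ℕ+) : constTerm K (psum n) = 0 := by
  classical
  change MvPowerSeries.coeff 0 (psum n : Lam K).1 = 0
  rw [coeff_psum, if_neg]
  rintro ⟨j, hj⟩
  exact n.pos.ne' (Finsupp.single_eq_zero.1 hj.symm)

variable [CharZero K]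

variable (K) in
/-- The expansion of products of power sums in augmented monomial symmetric functions. -/
def trans : Poly K →ₗ[K] Poly K := (augEquiv K).symm.toLinearMap ∘ₗ (psumHom K).toLinearMap

lemma augEquiv_apply (x : Poly K) : augEquiv K x = augLin K x := rfl

lemma augLin_trans (x : Poly K) : augLin K (trans K x) = psumHom K x :=
  (augEquiv K).apply_symm_apply _

lemma trans_one : trans K 1 = 1 := by
  apply (augEquiv K).injective
  rw [augEquiv_apply, augEquiv_apply, augLin_trans, augLin_one, map_one]

lemma trans_X_mul (n : ℕ+) (x : Poly K) :
    trans K (MvPolynomial.X n * x) = raise n (trans K x) := by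
  apply (augEquiv K).injective
  rw [augEquiv_apply, augEquiv_apply, augLin_trans, ← psum_mul_augLin, augLin_trans, map_mul,
    psumHom_X]

lemma trans_sub_mem_filt (k : ℕ) : ∀ x ∈ filt K (k + 1), trans K x - x ∈ filt K k := by
  induction k with
  | zero =>
    have : filt K (0 + 1) ≤ (filt K 0).comap (trans K - LinearMap.id) := by
      refine Submodule.span_le.2 ?_
      rintro _ ⟨s, hs, rfl⟩
      have hs' : s.degree < 0 + 1 := hs
      have h0 : s = 0 := by rw [← Finsupp.degree_eq_zero_iff]; omega
      subst h0
      change trans K 1 - 1 ∈ filt K _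
      rw [trans_one, sub_self]; exact zero_mem _
    exact this
  | succ k ih =>
    have : filt K (k + 1 + 1) ≤ (filt K (k + 1)).comap (trans K - LinearMap.id) := by
      refine Submodule.span_le.2 ?_
      rintro _ ⟨s, hs, rfl⟩
      have hs' : s.degree < k + 1 + 1 := hs
      change trans K (MvPolynomial.monomial s 1) - MvPolynomial.monomial s 1 ∈ filt K (k + 1)
      by_cases h0 : s = 0
      · subst h0
        change trans K 1 - 1 ∈ filt K _
        rw [trans_one, sub_self]; exact zero_mem _
      obtain ⟨n, hn⟩ := Finsupp.support_nonempty_iff.2 h0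
      have h2 : Finsupp.single n 1 + (s - Finsupp.single n 1) = s :=
        add_tsub_cancel_of_le (by
          simpa using Nat.one_le_iff_ne_zero.2 (Finsupp.mem_support_iff.1 hn))
      set t := s - Finsupp.single n 1
      have hdeg : t.degree < k + 1 := by
        have h3 := congrArg Finsupp.degree h2
        rw [map_add, Finsupp.degree_single] at h3
        omega
      have hmon : (MvPolynomial.monomial s 1 : Poly K) =
          MvPolynomial.X n * MvPolynomial.monomial t 1 := by
        rw [MvPolynomial.X, MvPolynomial.monomial_mul, h2, mul_one]
      have hm := monomial_mem_filt (K := K) hdeg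
      have h4 := ih _ hm
      have h5 : trans K (MvPolynomial.monomial t 1) ∈ filt K (k + 1) := by
        have := add_mem (filt_mono (Nat.le_succ k) h4) hm
        rwa [sub_add_cancel] at this
      rw [hmon, trans_X_mul, raise_apply, add_sub_right_comm, ← mul_sub]
      exact add_mem (X_mul_mem_filt n h4) (derivation_mem_filt n h5)
    exact this

lemma trans_bijective : Function.Bijective (trans K) := by
  constructor
  · rw [← LinearMap.ker_eq_bot, LinearMap.ker_eq_bot']
    intro x hx
    obtain ⟨k, hk⟩ := exists_mem_filt x
    induction k with
    | zero => simpa [filt_zero] using hk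
    | succ k ih =>
      apply ih
      have := trans_sub_mem_filt k x hk
      rw [hx, zero_sub] at this
      simpa using this
  · intro x
    obtain ⟨k, hk⟩ := exists_mem_filt x
    induction k generalizing x with
    | zero => exact ⟨0, by rw [filt_zero, Submodule.mem_bot] at hk; rw [hk, map_zero]⟩
    | succ k ih =>
      obtain ⟨y, hy⟩ := ih _ (trans_sub_mem_filt k x hk)
      exact ⟨x - y, by rw [map_sub, hy, sub_sub_cancel]⟩

lemma psumHom_bijective : Function.Bijective (psumHom K) := by
  have : ⇑(psumHom K) = augEquiv K ∘ trans K := by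
    funext x; exact (augLin_trans x).symm
  rw [this]
  exact (augEquiv K).bijective.comp trans_bijective

variable (K) in
/-- The power sums are algebraically independent and generate `Λ` as an algebra. -/
def psumEquiv : Poly K ≃ₐ[K] Lam K := AlgEquiv.ofBijective (psumHom K) psumHom_bijective

@[simp] lemma psumEquiv_X (n : ℕ+) : psumEquiv K (MvPolynomial.X n) = psum n := psumHom_X n

@[simp] lemma psumEquiv_symm_psum (n : ℕ+) :
    (psumEquiv K).symm (psum n) = MvPolynomial.X n := by
  rw [← psumEquiv_X, AlgEquiv.symm_apply_apply]

lemma algHom_ext {A : Type*} [Semiring A] [Algebra K A] {f g : Lam K →ₐ[K] A}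
    (h : ∀ n, f (psum n) = g (psum n)) : f = g := by
  have : f.comp (psumEquiv K).toAlgHom = g.comp (psumEquiv K).toAlgHom :=
    MvPolynomial.algHom_ext fun n => by simpa using h n
  ext x
  have := DFunLike.congr_fun this ((psumEquiv K).symm x)
  simpa using this

/-! ### The Hopf algebra `Λ` -/

variable (K) in
/-- The coproduct of `Λ`: the algebra map with `p_n ↦ p_n ⊗ 1 + 1 ⊗ p_n`. -/
def coproduct : Lam K →ₐ[K] Lam K ⊗[K] Lam K :=
  (MvPolynomial.aeval fun n => psum n ⊗ₜ[K] 1 + 1 ⊗ₜ[K] psum n).comp (psumEquiv K).symm.toAlgHom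

variable (K) in
/-- The antipode of `Λ`: the algebra map with `p_n ↦ -p_n`. -/
def negPsum : Lam K →ₐ[K] Lam K :=
  (MvPolynomial.aeval fun n => -psum n).comp (psumEquiv K).symm.toAlgHom

@[simp] lemma coproduct_psum (n : ℕ+) :
    coproduct K (psum n) = psum n ⊗ₜ[K] 1 + 1 ⊗ₜ[K] psum n := by simp [coproduct]

@[simp] lemma negPsum_psum (n : ℕ+) : negPsum K (psum n) = -psum n := by simp [negPsum]

instance : Bialgebra K (Lam K) :=
  Bialgebra.ofAlgHom (coproduct K) (constTerm K)
    (algHom_ext fun n => by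
      simp [TensorProduct.tmul_add, TensorProduct.add_tmul, Algebra.TensorProduct.one_def,
        add_assoc])
    (algHom_ext fun n => by simp)
    (algHom_ext fun n => by simp)

lemma comul_psum (n : ℕ+) : Coalgebra.comul (R := K) (psum n : Lam K) =
    psum n ⊗ₜ[K] 1 + 1 ⊗ₜ[K] psum n := coproduct_psum n

instance : HopfAlgebra K (Lam K) :=
  HopfAlgebra.ofAlgHom (negPsum K)
    (algHom_ext fun n => by
      have h := comul_psum (K := K) n
      have h2 : Coalgebra.counit (R := K) (psum n : Lam K) = 0 := constTerm_psum n
      simp only [AlgHom.comp_apply, Bialgebra.comulAlgHom_apply, h, map_add,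
        Bialgebra.counitAlgHom_apply, h2, map_zero]
      change negPsum K (psum n) * 1 + negPsum K 1 * psum n = 0
      simp)
    (algHom_ext fun n => by
      have h := comul_psum (K := K) n
      have h2 : Coalgebra.counit (R := K) (psum n : Lam K) = 0 := constTerm_psum n
      simp [h, h2])

end

section
variable {K : Type*} [Field K]

/-! ### The coproduct in the augmented monomial basis -/

variable (K) in
/-- The algebra map on polynomials that makes every generator primitive. -/
def polyCoproduct : Poly K →ₐ[K] Poly K ⊗[K] Poly K :=
  MvPolynomial.aeval fun n => MvPolynomial.X n ⊗ₜ[K] 1 + 1 ⊗ₜ[K] MvPolynomial.X n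

/-- The operator `f ⊗ 1 + 1 ⊗ f`. -/
def onBoth {A : Type*} [AddCommGroup A] [Module K A] (f : A →ₗ[K] A) : A ⊗[K] A →ₗ[K] A ⊗[K] A :=
  TensorProduct.map f LinearMap.id + TensorProduct.map LinearMap.id f

lemma onBoth_tmul {A : Type*} [AddCommGroup A] [Module K A] (f : A →ₗ[K] A) (a b : A) :
    onBoth f (a ⊗ₜ[K] b) = f a ⊗ₜ b + a ⊗ₜ f b := by simp [onBoth]

lemma onBoth_derivation (D : Derivation K (Poly K) (Poly K)) (u v : Poly K ⊗[K] Poly K) :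
    onBoth D.toLinearMap (u * v) = onBoth D.toLinearMap u * v + u * onBoth D.toLinearMap v := by
  induction u with
  | zero => simp
  | add u u' h h' => rw [add_mul, map_add, h, h', map_add, add_mul, add_mul]; abel
  | tmul a b =>
    induction v with
    | zero => simp
    | add v v' h h' => rw [mul_add, map_add, h, h', map_add, mul_add, mul_add]; abel
    | tmul c d =>
      have hD : ∀ x y : Poly K, D.toLinearMap (x * y) = x * D.toLinearMap y + D.toLinearMap x * y := by
        intro x y
        change D (x * y) = x * D y + D x * y
        rw [D.leibniz, smul_eq_mul, smul_eq_mul, mul_comm y]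
      rw [Algebra.TensorProduct.tmul_mul_tmul, onBoth_tmul, onBoth_tmul, onBoth_tmul, hD, hD,
        add_mul, mul_add]
      simp only [Algebra.TensorProduct.tmul_mul_tmul, TensorProduct.add_tmul,
        TensorProduct.tmul_add]
      abel

lemma polyCoproduct_derivation (n : ℕ+) (x : Poly K) :
    polyCoproduct K (MvPolynomial.mkDerivation K
      (fun i : ℕ+ => (MvPolynomial.X (i + n) : Poly K)) x) =
    onBoth (MvPolynomial.mkDerivation K
      (fun i : ℕ+ => (MvPolynomial.X (i + n) : Poly K))).toLinearMap (polyCoproduct K x) := by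
  set D := MvPolynomial.mkDerivation K (fun i : ℕ+ => (MvPolynomial.X (i + n) : Poly K)) with hD
  have hX : ∀ m, D (MvPolynomial.X m) = MvPolynomial.X (m + n) := fun m =>
    MvPolynomial.mkDerivation_X _ _ _
  have h1 : D 1 = 0 := D.map_one_eq_zero
  induction x using MvPolynomial.induction_on with
  | C a =>
    have h2 : (MvPolynomial.C a : Poly K) = a • 1 := by
      rw [MvPolynomial.smul_eq_C_mul, mul_one]
    rw [h2, D.map_smul, map_smul, map_smul, map_smul, h1, map_one, Algebra.TensorProduct.one_def,
      onBoth_tmul]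
    change a • polyCoproduct K 0 = a • (D 1 ⊗ₜ[K] 1 + 1 ⊗ₜ[K] D 1)
    simp [h1]
  | add f g hf hg => rw [map_add, map_add, map_add, map_add, hf, hg]
  | mul_X f m hf =>
    rw [D.leibniz, map_add, smul_eq_mul, smul_eq_mul, map_mul, map_mul, map_mul,
      onBoth_derivation, hf, hX, add_comm]
    have h3 : ∀ m, polyCoproduct K (MvPolynomial.X m) =
      MvPolynomial.X m ⊗ₜ[K] 1 + 1 ⊗ₜ[K] MvPolynomial.X m := fun m => by simp [polyCoproduct]
    have h4 : onBoth D.toLinearMap (polyCoproduct K (MvPolynomial.X m)) =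
        polyCoproduct K (MvPolynomial.X (m + n)) := by
      rw [h3, h3, map_add, onBoth_tmul, onBoth_tmul]
      change D _ ⊗ₜ[K] _ + _ ⊗ₜ[K] D _ + (D _ ⊗ₜ[K] _ + _ ⊗ₜ[K] D _) = _
      rw [hX, h1]; simp
    rw [h4, mul_comm (polyCoproduct K (MvPolynomial.X m))]

lemma polyCoproduct_raise (n : ℕ+) (x : Poly K) :
    polyCoproduct K (raise n x) = onBoth (raise n) (polyCoproduct K x) := by
  rw [raise_apply, map_add, polyCoproduct_derivation, map_mul]
  have h3 : polyCoproduct K (MvPolynomial.X n) =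
      MvPolynomial.X n ⊗ₜ[K] 1 + 1 ⊗ₜ[K] MvPolynomial.X n := by simp [polyCoproduct]
  rw [h3]
  generalize polyCoproduct K x = u
  induction u with
  | zero => simp
  | add u v hu hv => rw [map_add, map_add, ← hu, ← hv, mul_add]; abel
  | tmul a b =>
    rw [onBoth_tmul, onBoth_tmul, raise_apply, raise_apply]
    change (_ * _) + (MvPolynomial.mkDerivation K _ a ⊗ₜ[K] _ +
      _ ⊗ₜ[K] MvPolynomial.mkDerivation K _ b) = _
    rw [add_mul, Algebra.TensorProduct.tmul_mul_tmul, Algebra.TensorProduct.tmul_mul_tmul,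
      one_mul, one_mul, TensorProduct.add_tmul, TensorProduct.tmul_add]
    abel

variable [CharZero K]

/-- `p_n = m̃_n`. -/
lemma psum_eq_augMono (n : ℕ+) : (psum n : Lam K) = augMono (Finsupp.single n 1) := by
  have h := psum_mul_augLin (K := K) n 1
  rw [augLin_one, mul_one, raise_apply, Derivation.map_one_eq_zero, add_zero, mul_one] at h
  rw [h, ← augLin_monomial]; rfl

lemma map_augLin_onBoth (n : ℕ+) (u : Poly K ⊗[K] Poly K) :
    TensorProduct.map (augLin K) (augLin K) (onBoth (raise n) u) =
      (psum n ⊗ₜ[K] 1 + 1 ⊗ₜ[K] psum n) * TensorProduct.map (augLin K) (augLin K) u := by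
  induction u with
  | zero => simp
  | add u v hu hv => rw [map_add, map_add, hu, hv, map_add, mul_add]
  | tmul a b =>
    rw [onBoth_tmul, map_add, TensorProduct.map_tmul, TensorProduct.map_tmul,
      TensorProduct.map_tmul, ← psum_mul_augLin, ← psum_mul_augLin, add_mul,
      Algebra.TensorProduct.tmul_mul_tmul, Algebra.TensorProduct.tmul_mul_tmul, one_mul, one_mul]

lemma comul_augLin (x : Poly K) : Coalgebra.comul (R := K) (augLin K x) =
    TensorProduct.map (augLin K) (augLin K) (polyCoproduct K x) := by
  obtain ⟨y, rfl⟩ := trans_bijective.2 x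
  induction y using MvPolynomial.induction_on with
  | C a =>
    have h2 : (MvPolynomial.C a : Poly K) = a • 1 := by
      rw [MvPolynomial.smul_eq_C_mul, mul_one]
    rw [h2, map_smul, map_smul, map_smul, map_smul, map_smul, trans_one, augLin_one,
      Bialgebra.comul_one, map_one, Algebra.TensorProduct.one_def, Algebra.TensorProduct.one_def,
      TensorProduct.map_tmul, augLin_one]
  | add f g hf hg => simp only [map_add, hf, hg]
  | mul_X f n hf =>
    rw [mul_comm, trans_X_mul, ← psum_mul_augLin, Bialgebra.comul_mul, comul_psum, hf,
      polyCoproduct_raise, map_augLin_onBoth]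

lemma counit_augLin (x : Poly K) :
    Coalgebra.counit (R := K) (augLin K x) = MvPolynomial.constantCoeff x := by
  change MvPowerSeries.coeff 0 (augLin K x : MvPowerSeries ℕ K) = MvPolynomial.coeff 0 x
  rw [coeff_augLin, ptnOf_zero]
  simp [multFact]

/-! ### The Hopf algebra `Λ̃` -/

/-- The space `Λ̃`: the same vector space as `Λ`, but equipped below with the multiplication `⊙`
determined by `m̃_r ⊙ m̃_s = m̃_{r ⊔ s}`. -/
def LamT (K : Type*) [Field K] : Type _ := Lam K

instance : AddCommGroup (LamT K) := inferInstanceAs (AddCommGroup (Lam K))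

instance : Module K (LamT K) := inferInstanceAs (Module K (Lam K))

variable (K) in
/-- The identity map from `Λ` to `Λ̃`. -/
def toLamT : Lam K ≃ₗ[K] LamT K := LinearEquiv.refl K (Lam K)

variable (K) in
/-- The basis of augmented monomial symmetric functions of `Λ̃`. -/
def augEquivT : Poly K ≃ₗ[K] LamT K := (augEquiv K).trans (toLamT K)

instance : CommRing (LamT K) :=
  { (inferInstance : AddCommGroup (LamT K)) with
    mul := fun f g => augEquivT K ((augEquivT K).symm f * (augEquivT K).symm g)
    one := augEquivT K 1
    mul_assoc := fun f g h => by
      change augEquivT K ((augEquivT K).symm (augEquivT K _) * _) =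
        augEquivT K (_ * (augEquivT K).symm (augEquivT K _))
      rw [LinearEquiv.symm_apply_apply, LinearEquiv.symm_apply_apply, mul_assoc]
    one_mul := fun f => by
      change augEquivT K ((augEquivT K).symm (augEquivT K 1) * _) = f
      rw [LinearEquiv.symm_apply_apply, one_mul, LinearEquiv.apply_symm_apply]
    mul_one := fun f => by
      change augEquivT K (_ * (augEquivT K).symm (augEquivT K 1)) = f
      rw [LinearEquiv.symm_apply_apply, mul_one, LinearEquiv.apply_symm_apply]
    left_distrib := fun f g h => by
      change augEquivT K (_ * (augEquivT K).symm (g + h)) = augEquivT K _ + augEquivT K _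
      rw [map_add, mul_add, map_add]
    right_distrib := fun f g h => by
      change augEquivT K ((augEquivT K).symm (f + g) * _) = augEquivT K _ + augEquivT K _
      rw [map_add, add_mul, map_add]
    zero_mul := fun f => by
      change augEquivT K ((augEquivT K).symm 0 * _) = 0
      rw [map_zero, zero_mul, map_zero]
    mul_zero := fun f => by
      change augEquivT K (_ * (augEquivT K).symm 0) = 0
      rw [map_zero, mul_zero, map_zero]
    mul_comm := fun f g => by
      change augEquivT K _ = augEquivT K _
      rw [mul_comm] }

lemma augEquivT_mul (x y : Poly K) : augEquivT K (x * y) = augEquivT K x * augEquivT K y := by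
  change _ = augEquivT K (_ * _)
  rw [LinearEquiv.symm_apply_apply, LinearEquiv.symm_apply_apply]

lemma augEquivT_one : augEquivT K 1 = 1 := rfl

instance : Algebra K (LamT K) :=
  Algebra.ofModule
    (fun c f g => by
      obtain ⟨x, rfl⟩ := (augEquivT K).surjective f
      obtain ⟨y, rfl⟩ := (augEquivT K).surjective g
      rw [← map_smul, ← augEquivT_mul, ← augEquivT_mul, ← map_smul, smul_mul_assoc])
    (fun c f g => by
      obtain ⟨x, rfl⟩ := (augEquivT K).surjective f
      obtain ⟨y, rfl⟩ := (augEquivT K).surjective g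
      rw [← map_smul, ← augEquivT_mul, ← augEquivT_mul, ← map_smul, mul_smul_comm])

variable (K) in
/-- The polynomial ring is isomorphic to `Λ̃` by sending monomials to augmented monomial symmetric
functions. -/
def augAlgEquiv : Poly K ≃ₐ[K] LamT K :=
  AlgEquiv.ofLinearEquiv (augEquivT K) augEquivT_one augEquivT_mul

variable (K) in
/-- The part of `Λ̃` that is homogeneous of degree `n`, which is the same as that of `Λ`. -/
def homogT (n : ℕ) : Submodule K (LamT K) := (homog K n).map (toLamT K).toLinearMap

/-- The augmented monomial symmetric function `m̃_r` as an element of `Λ̃`. -/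
def augMonoT (r : Ptn) : LamT K := toLamT K (augMono r)

lemma augAlgEquiv_monomial (r : Ptn) :
    augAlgEquiv K (MvPolynomial.monomial r 1) = augMonoT r :=
  congrArg (toLamT K) (augLin_monomial r)

/-- The multiplication of `Λ̃` is the one determined by `m̃_r ⊙ m̃_s = m̃_{r ⊔ s}`. -/
lemma augMonoT_mul (r s : Ptn) : (augMonoT r * augMonoT s : LamT K) = augMonoT (r + s) := by
  rw [← augAlgEquiv_monomial, ← augAlgEquiv_monomial, ← augAlgEquiv_monomial, ← map_mul,
    MvPolynomial.monomial_mul, one_mul]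

/-- The coalgebra structure of `Λ̃` is the one of `Λ`. -/
instance : Coalgebra K (LamT K) := inferInstanceAs (Coalgebra K (Lam K))

lemma comul_augAlgEquiv (x : Poly K) : Coalgebra.comul (R := K) (augAlgEquiv K x) =
    Algebra.TensorProduct.map (augAlgEquiv K).toAlgHom (augAlgEquiv K).toAlgHom
      (polyCoproduct K x) := comul_augLin x

lemma counit_augAlgEquiv (x : Poly K) : Coalgebra.counit (R := K) (augAlgEquiv K x) =
    MvPolynomial.constantCoeff x := counit_augLin x

instance : Bialgebra K (LamT K) :=
  Bialgebra.mk' K (LamT K)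
    (by rw [← map_one (augAlgEquiv K), counit_augAlgEquiv, map_one])
    (fun {a b} => by
      obtain ⟨x, rfl⟩ := (augAlgEquiv K).surjective a
      obtain ⟨y, rfl⟩ := (augAlgEquiv K).surjective b
      rw [← map_mul, counit_augAlgEquiv, counit_augAlgEquiv, counit_augAlgEquiv, map_mul])
    (by rw [← map_one (augAlgEquiv K), comul_augAlgEquiv, map_one, map_one])
    (fun {a b} => by
      obtain ⟨x, rfl⟩ := (augAlgEquiv K).surjective a
      obtain ⟨y, rfl⟩ := (augAlgEquiv K).surjective b
      rw [← map_mul, comul_augAlgEquiv, comul_augAlgEquiv, comul_augAlgEquiv, map_mul, map_mul])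

lemma algHomT_ext {A : Type*} [Semiring A] [Algebra K A] {f g : LamT K →ₐ[K] A}
    (h : ∀ n : ℕ+, f (augMonoT (Finsupp.single n 1)) = g (augMonoT (Finsupp.single n 1))) :
    f = g := by
  have : f.comp (augAlgEquiv K).toAlgHom = g.comp (augAlgEquiv K).toAlgHom :=
    MvPolynomial.algHom_ext fun n => by
      have := h n
      rw [← augAlgEquiv_monomial] at this
      exact this
  ext x
  have := DFunLike.congr_fun this ((augAlgEquiv K).symm x)
  simpa using this

lemma comul_augMonoT (n : ℕ+) :
    Coalgebra.comul (R := K) (augMonoT (Finsupp.single n 1) : LamT K) =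
      augMonoT (Finsupp.single n 1) ⊗ₜ[K] 1 + 1 ⊗ₜ[K] augMonoT (Finsupp.single n 1) := by
  rw [← augAlgEquiv_monomial, comul_augAlgEquiv]
  change Algebra.TensorProduct.map _ _ (polyCoproduct K (MvPolynomial.X n)) =
    augAlgEquiv K (MvPolynomial.X n) ⊗ₜ[K] 1 + 1 ⊗ₜ[K] augAlgEquiv K (MvPolynomial.X n)
  simp [polyCoproduct]

lemma counit_augMonoT (n : ℕ+) :
    Coalgebra.counit (R := K) (augMonoT (Finsupp.single n 1) : LamT K) = 0 := by
  rw [← augAlgEquiv_monomial, counit_augAlgEquiv]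
  exact MvPolynomial.constantCoeff_X _ _

variable (K) in
/-- The antipode of `Λ̃`: the algebra map with `m̃_n ↦ -m̃_n`. -/
def negAug : LamT K →ₐ[K] LamT K :=
  (MvPolynomial.aeval fun n => -augMonoT (Finsupp.single n 1)).comp (augAlgEquiv K).symm.toAlgHom

lemma negAug_augMonoT (n : ℕ+) :
    negAug K (augMonoT (Finsupp.single n 1)) = -augMonoT (Finsupp.single n 1) := by
  have h : (augAlgEquiv K).symm (augMonoT (Finsupp.single n 1)) = MvPolynomial.X n := by
    rw [← augAlgEquiv_monomial, AlgEquiv.symm_apply_apply]; rfl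
  simp [negAug, h]

instance : HopfAlgebra K (LamT K) :=
  HopfAlgebra.ofAlgHom (negAug K)
    (algHomT_ext fun n => by
      simp only [AlgHom.comp_apply, Bialgebra.comulAlgHom_apply, comul_augMonoT, map_add,
        Bialgebra.counitAlgHom_apply, counit_augMonoT, map_zero]
      change negAug K (augMonoT _) * 1 + negAug K 1 * augMonoT _ = 0
      simp [negAug_augMonoT])
    (algHomT_ext fun n => by
      simp only [AlgHom.comp_apply, Bialgebra.comulAlgHom_apply, comul_augMonoT, map_add,
        Bialgebra.counitAlgHom_apply, counit_augMonoT, map_zero]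
      change augMonoT _ * negAug K 1 + 1 * negAug K (augMonoT _) = 0
      simp [negAug_augMonoT])

/-! ### Chromatic symmetric functions of weighted graphs -/

end

section
variable (K : Type*) [Field K] {V : Type*} [Fintype V]

/-- The proper colorings of `G` with colors in `ℕ` whose monomial `∏ v, x_{κ v} ^ (w v)` is
`x ^ d`. -/
def coloringsOf (G : SimpleGraph V) (w : V → ℕ+) (d : ℕ →₀ ℕ) : Set (G.Coloring ℕ) :=
  {κ | ∑ v, Finsupp.single (κ v) (w v : ℕ) = d}

lemma coloringsOf_finite (G : SimpleGraph V) (w : V → ℕ+) (d : ℕ →₀ ℕ) :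
    (coloringsOf G w d).Finite := by
  classical
  refine Set.Finite.of_finite_image (f := fun κ : G.Coloring ℕ => (κ : V → ℕ)) ?_
    (DFunLike.coe_injective.injOn)
  refine (Set.Finite.pi' (t := fun _ : V => (d.support : Set ℕ))
    fun _ => d.support.finite_toSet).subset ?_
  rintro _ ⟨κ, hκ, rfl⟩ v
  have hκ' : ∑ v, Finsupp.single (κ v) (w v : ℕ) = d := hκ
  rw [Finset.mem_coe, Finsupp.mem_support_iff, ← hκ', Finsupp.finsetSum_apply]
  have h1 : (Finsupp.single (κ v) (w v : ℕ)) (κ v) ≤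
      ∑ u, (Finsupp.single (κ u) (w u : ℕ)) (κ v) :=
    Finset.single_le_sum (f := fun u => (Finsupp.single (κ u) (w u : ℕ)) (κ v))
      (fun _ _ => Nat.zero_le _) (Finset.mem_univ v)
  have := (w v).pos
  simp only [Finsupp.single_eq_same] at h1
  exact (lt_of_lt_of_le this h1).ne'

/-- The chromatic symmetric function `X_G = ∑_κ ∏_v x_{κ v} ^ (w v)` of the graph `G` with vertex
weights `w`, where `κ` ranges over all proper colorings of `G`: the coefficient of a monomial is
the (finite) number of proper colorings that contribute this monomial. -/
def csf (G : SimpleGraph V) (w : V → ℕ+) : Lam K :=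
  ⟨fun d => ((coloringsOf G w d).ncard : K), by
    refine ⟨fun σ d => ?_, ∑ v, (w v : ℕ), fun d hd => ?_⟩
    · change ((coloringsOf G w (d.mapDomain σ)).ncard : K) = ((coloringsOf G w d).ncard : K)
      congr 1
      symm
      refine Set.ncard_congr
        (fun κ _ => (⟨fun v => σ (κ v), fun {a b} h => by
          simpa using κ.valid h⟩ : G.Coloring ℕ)) ?_ ?_ ?_
      · rintro κ hκ
        have hκ' : ∑ v, Finsupp.single (κ v) (w v : ℕ) = d := hκ
        change ∑ v, Finsupp.single (σ (κ v)) (w v : ℕ) = _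
        rw [← hκ', Finsupp.mapDomain_finsetSum]
        simp
      · intro κ κ' _ _ h
        ext v
        exact σ.injective (DFunLike.congr_fun h v)
      · intro κ hκ
        have hκ' : ∑ v, Finsupp.single (κ v) (w v : ℕ) = d.mapDomain σ := hκ
        refine ⟨⟨fun v => σ.symm (κ v), fun {a b} h => by simpa using κ.valid h⟩, ?_, ?_⟩
        · change ∑ v, Finsupp.single (σ.symm (κ v)) (w v : ℕ) = d
          apply Finsupp.mapDomain_injective σ.injective
          rw [← hκ', Finsupp.mapDomain_finsetSum]
          simp
        · ext v
          exact σ.apply_symm_apply _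
    · have hne : (coloringsOf G w d).Nonempty := by
        by_contra h
        rw [Set.not_nonempty_iff_eq_empty] at h
        apply hd
        change ((coloringsOf G w d).ncard : K) = 0
        rw [h]; simp
      obtain ⟨κ, hκ⟩ := hne
      have hκ' : ∑ v, Finsupp.single (κ v) (w v : ℕ) = d := hκ
      rw [← hκ', map_sum]
      simp⟩

end

/-- The weight of a nonempty set of vertices: the sum of the weights of its elements. -/
def setWeight {V : Type*} (w : V → ℕ+) (s : Finset V) (hs : s.Nonempty) : ℕ+ :=
  ⟨∑ v ∈ s, (w v : ℕ), Finset.sum_pos (fun v _ => (w v).pos) hs⟩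

end SymFunc

end

/-! Fix a vertex `v` of a nonempty vertex set `S` and write X(S) for the chromatic symmetric
function of the induced subgraph. Two recursions remove from `S` a block `B` containing `v`.

In Λ, X(S) is the sum over all such `B` of c(B) p_{w(B)} X(S \ B), where c is `blockCoeff`, in
effect the linear coefficient of the chromatic polynomial of G[B] (`csfOn_eq_sum_psum_mul`). The
right side counts colorings that are constant on `B` and proper off `B`. For a given coloring, the
admissible blocks lie inside the color class T of `v`, and the recursion that defines c makes their
coefficients add up to 1 if T is independent and to 0 otherwise.

In Λ̃, X(S) is the sum over independent `B` of m̃_{w(B)} ⊙ X(S \ B), because multiplication by m̃_n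
uses a fresh variable, so that `B` is the whole color class of `v` (`csfOn_eq_sum_augMonoT_mul`).

Apply the first recursion to G and the second to its complement, whose independent sets are the
cliques of G. A morphism that scales p_n to a(n) m̃_n carries one recursion into the other if c(B)
a(w(B)) is 1 for cliques and 0 for all other blocks. Now c(B) is (-1)^{k-1}(k-1)! on a clique of
size k (`blockCoeff_clique`), it is 0 on disconnected sets (`blockCoeff_eq_zero_of_not_connected`),
and on the remaining sets a vanishes by hypothesis. Induction on `S` finishes the argument
(`scaleHom_csfOn`).

Such a morphism exists for every scaling a: the p_n generate Λ freely, and both p_n and m̃_n are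
primitive. It respects degrees because it is diagonal from products of power sums to augmented
monomials. -/

noncomputable section

namespace SymFunc

open scoped Classical Nat

/-! ### Block coefficients of a graph -/

section
variable {V : Type*} (G : SimpleGraph V)

/-- The coefficient of the vertex set `T` in the expansion of a chromatic symmetric function in
power sums along the blocks that contain the vertex `v`. -/
def blockCoeff (v : V) (T : Finset V) : ℤ :=
  -- The subtraction over proper subsets is arranged so that the sum over all `B`, with `T`
  -- included, is the indicator of independence. Summing over a subtype keeps the membership proof
  -- available for termination.
  (if G.IsIndepSet (T : Set V) then 1 else 0) -
    ∑ B : {B // B ∈ T.ssubsets.filter fun B => v ∈ B ∧ G.IsIndepSet ((T \ B : Finset V) : Set V)},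
      blockCoeff v B.1
termination_by T.card
decreasing_by
  have := B.2
  rw [Finset.mem_filter, Finset.mem_ssubsets] at this
  exact Finset.card_lt_card this.1

/-- The recursion solved for its indicator; every later fact about the coefficients comes from this
form. The condition `v ∈ T` is what makes `T` itself one of the blocks. -/
lemma sum_blockCoeff (v : V) (T : Finset V) (hv : v ∈ T) :
    ∑ B ∈ T.powerset with v ∈ B ∧ G.IsIndepSet ((T \ B : Finset V) : Set V), blockCoeff G v B =
      if G.IsIndepSet (T : Set V) then 1 else 0 := by
  have h : (T.powerset.filter fun B => v ∈ B ∧ G.IsIndepSet ((T \ B : Finset V) : Set V)) =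
      insert T (T.ssubsets.filter fun B => v ∈ B ∧ G.IsIndepSet ((T \ B : Finset V) : Set V)) := by
    ext B
    simp only [Finset.mem_filter, Finset.mem_powerset, Finset.mem_insert, Finset.mem_ssubsets]
    constructor
    · rintro ⟨h1, h2⟩
      rcases h1.eq_or_ssubset with h | h
      · exact Or.inl h
      · exact Or.inr ⟨h, h2⟩
    · rintro (rfl | ⟨h1, h2⟩)
      · exact ⟨subset_rfl, hv, by simp⟩
      · exact ⟨h1.subset, h2⟩
  rw [h, Finset.sum_insert (by simp), blockCoeff,
    Finset.sum_coe_sort _ (fun B => blockCoeff G v B), sub_add_cancel]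

/-- By induction, a block `B ≠ T` not contained in `C` has coefficient 0, since `B ∩ C` separates
it. As no edge joins `C` to `T \ C`, the blocks inside `C` sum to the indicator for `C` times that
for `T \ C`, which is the indicator for `T`. Nothing remains for `T` itself. -/
lemma blockCoeff_eq_zero (v : V) (T C : Finset V) (hCT : C ⊂ T) (hv : v ∈ C)
    (hadj : ∀ x ∈ C, ∀ y ∈ T \ C, ¬ G.Adj x y) : blockCoeff G v T = 0 := by
  induction T using Finset.strongInduction generalizing C with
  | H T ih =>
    have hT := sum_blockCoeff G v T (hCT.subset hv)
    rw [← Finset.add_sum_erase _ _ (a := T) (by simp [hCT.subset hv])] at hT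
    have hrest : ∑ B ∈ (T.powerset.filter fun B =>
          v ∈ B ∧ G.IsIndepSet ((T \ B : Finset V) : Set V)).erase T, blockCoeff G v B =
        if G.IsIndepSet (T : Set V) then 1 else 0 := by
      have hind : ∀ B ⊆ C, G.IsIndepSet ((T \ B : Finset V) : Set V) ↔
          G.IsIndepSet ((C \ B : Finset V) : Set V) ∧
            G.IsIndepSet ((T \ C : Finset V) : Set V) := by
        intro B hB
        constructor
        · intro h
          refine ⟨h.mono ?_, h.mono ?_⟩
          · exact_mod_cast Finset.sdiff_subset_sdiff hCT.subset subset_rfl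
          · exact_mod_cast Finset.sdiff_subset_sdiff subset_rfl hB
        · rintro ⟨h1, h2⟩ x hx y hy hxy
          rw [Finset.mem_coe, Finset.mem_sdiff] at hx hy
          by_cases hxC : x ∈ C <;> by_cases hyC : y ∈ C
          · exact h1 (by simp [hxC, hx]) (by simp [hyC, hy]) hxy
          · exact hadj x hxC y (by simp [hyC, hy])
          · exact fun h => hadj y hyC x (by simp [hxC, hx]) h.symm
          · exact h2 (by simp [hxC, hx]) (by simp [hyC, hy]) hxy
      have hC := sum_blockCoeff G v C hv
      -- With the empty block, this factors the independence of `T` over `C` and `T \ C`.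
      have h0 := hind ∅ (by simp)
      rw [Finset.sdiff_empty, Finset.sdiff_empty] at h0
      by_cases hD : G.IsIndepSet ((T \ C : Finset V) : Set V)
      · rw [if_congr (h0.trans (and_iff_left hD)) rfl rfl, ← hC]
        symm
        refine Finset.sum_subset ?_ ?_
        · intro B hB
          simp only [Finset.mem_filter, Finset.mem_powerset] at hB
          simp only [Finset.mem_erase, Finset.mem_filter, Finset.mem_powerset]
          refine ⟨?_, hB.1.trans hCT.subset, hB.2.1, (hind B hB.1).2 ⟨hB.2.2, hD⟩⟩
          rintro rfl
          exact hCT.not_subset hB.1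
        · intro B hB hBC
          simp only [Finset.mem_erase, Finset.mem_filter, Finset.mem_powerset] at hB
          have hnot : ¬ B ⊆ C := by
            intro h
            apply hBC
            simp only [Finset.mem_filter, Finset.mem_powerset]
            exact ⟨h, hB.2.2.1, ((hind B h).1 hB.2.2.2).1⟩
          refine ih B (hB.2.1.ssubset_of_ne hB.1) (B ∩ C) ?_ (by simp [hv, hB.2.2.1]) ?_
          · refine Finset.inter_subset_left.ssubset_of_ne ?_
            rwa [Ne, Finset.inter_eq_left]
          · intro x hx y hy
            simp only [Finset.mem_inter, Finset.mem_sdiff, not_and] at hx hy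
            exact hadj x hx.2 y (by simp [hB.2.1 hy.1, hy.2 hy.1])
      -- If `T \ C` contains an edge, no block inside `C` is admissible and `T` is not independent,
      -- so both sides are 0.
      · rw [if_neg (fun h => hD (h0.1 h).2)]
        refine Finset.sum_eq_zero fun B hB => ?_
        simp only [Finset.mem_erase, Finset.mem_filter, Finset.mem_powerset] at hB
        have hnot : ¬ B ⊆ C := fun h => hD ((hind B h).1 hB.2.2.2).2
        refine ih B (hB.2.1.ssubset_of_ne hB.1) (B ∩ C) ?_ (by simp [hv, hB.2.2.1]) ?_
        · refine Finset.inter_subset_left.ssubset_of_ne ?_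
          rwa [Ne, Finset.inter_eq_left]
        · intro x hx y hy
          simp only [Finset.mem_inter, Finset.mem_sdiff, not_and] at hx hy
          exact hadj x hx.2 y (by simp [hB.2.1 hy.1, hy.2 hy.1])
    rw [hrest] at hT
    linarith

/-- In a clique the complement of a block is independent only if it has at most one vertex, and that
vertex is not `v`. A clique with k + 2 vertices thus has k + 1 proper admissible blocks, each a
clique with k + 1 vertices, and the recursion multiplies the coefficient by -(k + 1). -/
lemma blockCoeff_clique (v : V) (k : ℕ) (T : Finset V) (hv : v ∈ T)
    (hT : G.IsNClique (k + 1) T) : blockCoeff G v T = (-1) ^ k * k ! := by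
  induction k generalizing T with
  | zero =>
    obtain ⟨x, rfl⟩ := Finset.card_eq_one.1 hT.card_eq
    obtain rfl : v = x := by simpa using hv
    have h := sum_blockCoeff G v {v} (by simp)
    rw [Finset.sum_eq_single {v}] at h
    · rw [h, if_pos]
      · simp
      · simp [SimpleGraph.IsIndepSet]
    · intro B hB hne
      simp only [Finset.mem_filter, Finset.mem_powerset] at hB
      exact absurd (hB.1.antisymm (by simpa using hB.2.1)) hne
    · simp
  | succ k ih =>
    have h := sum_blockCoeff G v T hv
    have hset : (T.powerset.filter fun B => v ∈ B ∧ G.IsIndepSet ((T \ B : Finset V) : Set V)) =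
        insert T ((T.erase v).image fun u => T.erase u) := by
      ext B
      simp only [Finset.mem_filter, Finset.mem_powerset, Finset.mem_insert, Finset.mem_image,
        Finset.mem_erase]
      constructor
      · rintro ⟨h1, h2, h3⟩
        rcases Finset.eq_empty_or_nonempty (T \ B) with h4 | ⟨u, hu⟩
        · exact Or.inl (h1.antisymm (Finset.sdiff_eq_empty_iff_subset.1 h4))
        · refine Or.inr ⟨u, ⟨?_, (Finset.mem_sdiff.1 hu).1⟩, ?_⟩
          · rintro rfl
            exact (Finset.mem_sdiff.1 hu).2 h2
          · ext x
            rw [Finset.mem_erase]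
            constructor
            · rintro ⟨hxu, hxT⟩
              by_contra hxB
              exact h3 (by simp [hxT, hxB]) (Finset.mem_coe.2 hu) hxu
                (hT.isClique hxT (Finset.mem_sdiff.1 hu).1 hxu)
            · intro hx
              exact ⟨fun h => (Finset.mem_sdiff.1 hu).2 (h ▸ hx), h1 hx⟩
      · rintro (rfl | ⟨u, ⟨huv, huT⟩, rfl⟩)
        · exact ⟨subset_rfl, hv, by simp⟩
        · refine ⟨Finset.erase_subset _ _, ?_, ?_⟩
          · simp [hv, Ne.symm huv]
          · rw [Finset.sdiff_erase huT]
            simp [SimpleGraph.IsIndepSet]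
    have hnind : ¬ G.IsIndepSet (T : Set V) := by
      obtain ⟨x, hx, y, hy, hxy⟩ := Finset.one_lt_card.1
        (show 1 < T.card by rw [hT.card_eq]; omega)
      exact fun h => h hx hy hxy (hT.isClique hx hy hxy)
    rw [hset, Finset.sum_insert, Finset.sum_image, if_neg hnind,
      Finset.sum_congr rfl (g := fun _ => (-1) ^ k * (k ! : ℤ)), Finset.sum_const,
      Finset.card_erase_of_mem hv, hT.card_eq] at h
    · rw [Nat.factorial_succ, pow_succ]
      simp only [Nat.add_sub_cancel, nsmul_eq_mul] at h
      push_cast at h ⊢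
      linear_combination h
    · intro u hu
      rw [Finset.mem_erase] at hu
      refine ih _ (by simp [hv, Ne.symm hu.1]) ⟨?_, ?_⟩
      · exact hT.isClique.subset (by simp)
      · rw [Finset.card_erase_of_mem hu.2, hT.card_eq]; omega
    · intro x hx y hy hxy
      simp only [Finset.coe_erase] at hx hy
      by_contra hne
      have : x ∈ T.erase y := Finset.mem_erase.2 ⟨hne, Finset.mem_coe.1 hx.1⟩
      rw [← show T.erase x = T.erase y from hxy] at this
      simp at this
    · simp only [Finset.mem_image, Finset.mem_erase, not_exists, not_and, and_imp]
      intro u _ hu h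
      exact Finset.notMem_erase u T (h.symm ▸ hu)

/-- The separating set is the connected component of `v` in the induced subgraph; it is proper
because that graph is not connected. -/
lemma blockCoeff_eq_zero_of_not_connected (v : V) (T : Finset V) (hv : v ∈ T)
    (hT : ¬ (G.induce (T : Set V)).Connected) : blockCoeff G v T = 0 := by
  let C : Finset V := T.filter fun x =>
    ∃ h : x ∈ (T : Set V), (G.induce (T : Set V)).Reachable ⟨v, hv⟩ ⟨x, h⟩
  refine blockCoeff_eq_zero G v T C ?_ ?_ ?_
  · refine (Finset.filter_subset _ _).ssubset_of_ne fun h => hT ?_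
    have hr : ∀ x : (T : Set V), (G.induce (T : Set V)).Reachable ⟨v, hv⟩ x := by
      intro x
      have hx : (x : V) ∈ C := by
        rw [show C = T from h]; exact x.2
      exact (Finset.mem_filter.1 hx).2.2
    have : Nonempty (T : Set V) := ⟨⟨v, hv⟩⟩
    exact ⟨fun x y => (hr x).symm.trans (hr y)⟩
  · exact Finset.mem_filter.2 ⟨hv, hv, SimpleGraph.Reachable.refl _⟩
  · intro x hx y hy hxy
    obtain ⟨hxT, hxT', hr⟩ := Finset.mem_filter.1 hx
    obtain ⟨hyT, hyC⟩ := Finset.mem_sdiff.1 hy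
    refine hyC (Finset.mem_filter.2 ⟨hyT, hyT, hr.trans (SimpleGraph.Adj.reachable ?_)⟩)
    simpa using hxy

end

/-! ### Color classes and contents of colorings -/

section
variable {V : Type*}

/-- Weights are positive, so every color used appears in the monomial. -/
lemma apply_ne_zero_of_content {w : V → ℕ+} {S : Finset V} {d : ℕ →₀ ℕ} {κ : V → ℕ}
    (h : ∑ v ∈ S, Finsupp.single (κ v) (w v : ℕ) = d) {v : V} (hv : v ∈ S) : d (κ v) ≠ 0 := by
  rw [← h, Finsupp.finsetSum_apply]
  refine (lt_of_lt_of_le (w v).pos ?_).ne'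
  have := Finset.single_le_sum (f := fun u => (Finsupp.single (κ u) (w u : ℕ)) (κ v))
      (fun _ _ => Nat.zero_le _) hv
  simpa using this

/-- The function `κ` gives different colors to adjacent vertices of `S`. -/
def ProperOn (G : SimpleGraph V) (κ : V → ℕ) (S : Finset V) : Prop :=
  ∀ x ∈ S, ∀ y ∈ S, G.Adj x y → κ x ≠ κ y

lemma properOn_congr {G : SimpleGraph V} {κ κ' : V → ℕ} {S : Finset V}
    (h : ∀ x ∈ S, κ x = κ' x) : ProperOn G κ S ↔ ProperOn G κ' S := by
  refine forall₄_congr fun x hx y hy => ?_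
  rw [h x hx, h y hy]

/-- Vertices of equal color lie both in the color class of `v` or both outside it, so conflicts off
`B` split into two kinds. The second factor is exactly the condition in the recursion for
`blockCoeff`. -/
lemma properOn_iff_of_const (G : SimpleGraph V) (κ : V → ℕ) {B S : Finset V} {v : V}
    (hBS : B ⊆ S.filter (κ · = κ v)) :
    ProperOn G κ (S \ B) ↔ ProperOn G κ (S \ S.filter (κ · = κ v)) ∧
      G.IsIndepSet ((S.filter (κ · = κ v) \ B : Finset V) : Set V) := by
  constructor
  · intro h
    refine ⟨fun x hx y hy => h x ?_ y ?_, fun x hx y hy _ hxy => ?_⟩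
    · exact Finset.sdiff_subset_sdiff subset_rfl hBS hx
    · exact Finset.sdiff_subset_sdiff subset_rfl hBS hy
    · simp only [Finset.coe_sdiff, Set.mem_sdiff, Finset.mem_coe, Finset.mem_filter] at hx hy
      exact h x (by simp [hx]) y (by simp [hy]) hxy (hx.1.2.trans hy.1.2.symm)
  · rintro ⟨h1, h2⟩ x hx y hy hxy hκ
    rw [Finset.mem_sdiff] at hx hy
    by_cases hxv : κ x = κ v
    · exact h2 (by simp [hx, hxv]) (by simp [hy, ← hκ, hxv]) hxy.ne hxy
    · exact h1 x (by simp [hx, hxv]) y (by simp [hy, ← hκ, hxv]) hxy hκ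

/-- The weight of a set of vertices, with the value `1` at the empty set. -/
def blockWeight (w : V → ℕ+) (B : Finset V) : ℕ+ :=
  if h : B.Nonempty then setWeight w B h else 1

lemma blockWeight_of_nonempty (w : V → ℕ+) {B : Finset V} (h : B.Nonempty) :
    blockWeight w B = setWeight w B h := dif_pos h

lemma coe_blockWeight (w : V → ℕ+) {B : Finset V} (h : B.Nonempty) :
    (blockWeight w B : ℕ) = ∑ v ∈ B, (w v : ℕ) := by
  rw [blockWeight_of_nonempty w h]; rfl

/-- A monochromatic block acts like one vertex carrying its total weight. -/
lemma sum_single_split (w : V → ℕ+) {B S : Finset V} (hB : B.Nonempty) (hBS : B ⊆ S) (κ : V → ℕ)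
    (j : ℕ) (hκ : ∀ x ∈ B, κ x = j) :
    ∑ v ∈ S, Finsupp.single (κ v) (w v : ℕ) =
      Finsupp.single j (blockWeight w B : ℕ) +
        ∑ v ∈ S \ B, Finsupp.single (κ v) (w v : ℕ) := by
  rw [← Finset.sum_sdiff hBS, add_comm, coe_blockWeight w hB, Finsupp.single_finsetSum]
  congr 1
  exact Finset.sum_congr rfl fun x hx => by rw [hκ x hx]

end

/-! ### Coefficients of chromatic symmetric functions of induced subgraphs -/

section
variable {K : Type*} [Field K] {V : Type*} [Fintype V]

/-- The functions `κ` on the vertices that vanish off `S` and for which the monomial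
`∏ v ∈ S, x_{κ v} ^ (w v)` is `x ^ d`. -/
def contentFns (w : V → ℕ+) (S : Finset V) (d : ℕ →₀ ℕ) : Finset (V → ℕ) :=
  (Fintype.piFinset fun v => if v ∈ S then d.support else {0}).filter fun κ =>
    ∑ v ∈ S, Finsupp.single (κ v) (w v : ℕ) = d

/-- Restricting the colors to `d.support` serves only finiteness: the content condition already
forces it. -/
lemma mem_contentFns {w : V → ℕ+} {S : Finset V} {d : ℕ →₀ ℕ} {κ : V → ℕ} :
    κ ∈ contentFns w S d ↔
      (∀ v ∉ S, κ v = 0) ∧ ∑ v ∈ S, Finsupp.single (κ v) (w v : ℕ) = d := by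
  rw [contentFns, Finset.mem_filter, Fintype.mem_piFinset]
  refine and_congr_left fun h => ⟨fun h1 v hv => by simpa [hv] using h1 v, fun h1 v => ?_⟩
  by_cases hv : v ∈ S
  · simpa [hv] using apply_ne_zero_of_content h hv
  · simpa [hv] using h1 v hv

/-- Extension by zero turns colorings of a subgraph into functions on all of `V`, so that different
subsets can be compared. A general embedding covers both the inclusion of a subset and the identity
of `V`. -/
lemma coeff_csf_comap {U : Type*} [Fintype U] (ι : U ↪ V) (G : SimpleGraph V) (w : V → ℕ+)
    (d : ℕ →₀ ℕ) :
    MvPowerSeries.coeff d (csf K (G.comap ι) (w ∘ ι)).1 =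
      ∑ κ ∈ contentFns w (Finset.univ.map ι) d,
        if ProperOn G κ (Finset.univ.map ι) then 1 else 0 := by
  rw [Finset.sum_boole]
  change ((coloringsOf (G.comap ι) (w ∘ ι) d).ncard : K) = _
  congr 1
  rw [← Set.ncard_coe_finset]
  refine Set.ncard_congr (fun κ _ => Function.extend ι κ 0) ?_ ?_ ?_
  · intro κ hκ
    have hκ' : ∑ v, Finsupp.single (κ v) (w (ι v) : ℕ) = d := hκ
    rw [Finset.mem_coe, Finset.mem_filter, mem_contentFns]
    refine ⟨⟨fun v hv => ?_, ?_⟩, ?_⟩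
    · rw [Function.extend_apply', Pi.zero_apply]
      rintro ⟨u, rfl⟩
      simp at hv
    · simpa [ι.injective.extend_apply] using hκ'
    · intro x hx y hy hxy
      obtain ⟨x, _, rfl⟩ := Finset.mem_map.1 hx
      obtain ⟨y, _, rfl⟩ := Finset.mem_map.1 hy
      rw [ι.injective.extend_apply, ι.injective.extend_apply]
      exact κ.valid hxy
  · intro κ κ' _ _ h
    ext u
    have := congrFun h (ι u)
    rwa [ι.injective.extend_apply, ι.injective.extend_apply] at this
  · intro κ hκ
    rw [Finset.mem_coe, Finset.mem_filter, mem_contentFns] at hκ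
    refine ⟨⟨fun u => κ (ι u), fun {a b} h => hκ.2 _ (by simp) _ (by simp) h⟩, ?_, ?_⟩
    · have := hκ.1.2
      rwa [Finset.sum_map] at this
    · funext v
      by_cases hv : v ∈ Finset.univ.map ι
      · obtain ⟨u, _, rfl⟩ := Finset.mem_map.1 hv
        rw [ι.injective.extend_apply]; rfl
      · rw [Function.extend_apply', hκ.1.1 v hv, Pi.zero_apply]
        rintro ⟨u, rfl⟩
        simp at hv

variable (K) in
/-- The chromatic symmetric function of the subgraph induced on the vertex set `S`. -/
def csfOn (G : SimpleGraph V) (w : V → ℕ+) (S : Finset V) : Lam K :=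
  csf K (G.comap (Function.Embedding.subtype (· ∈ S))) (w ∘ Function.Embedding.subtype (· ∈ S))

lemma coeff_csfOn (G : SimpleGraph V) (w : V → ℕ+) (S : Finset V) (d : ℕ →₀ ℕ) :
    MvPowerSeries.coeff d (csfOn K G w S).1 =
      ∑ κ ∈ contentFns w S d, if ProperOn G κ S then 1 else 0 := by
  have hS : Finset.univ.map (Function.Embedding.subtype (· ∈ S)) = S := by
    ext; simp
  rw [csfOn, coeff_csf_comap, hS]

lemma csfOn_univ (G : SimpleGraph V) (w : V → ℕ+) : csfOn K G w Finset.univ = csf K G w := by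
  apply Subtype.ext
  ext d
  have h := coeff_csf_comap (K := K) (Function.Embedding.refl V) G w d
  rw [Finset.map_refl] at h
  exact (coeff_csfOn G w _ d).trans h.symm

lemma csfOn_empty (G : SimpleGraph V) (w : V → ℕ+) : csfOn K G w ∅ = 1 := by
  apply Subtype.ext
  ext d
  rw [coeff_csfOn]
  change _ = MvPowerSeries.coeff d 1
  rw [MvPowerSeries.coeff_one]
  have hP : ∀ κ, ProperOn G κ ∅ := fun κ x hx => by simp at hx
  simp only [hP, if_true, Finset.sum_const, nsmul_eq_mul, mul_one]
  split_ifs with h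
  · rw [Finset.card_eq_one.2 ⟨0, ?_⟩, Nat.cast_one]
    ext κ
    rw [mem_contentFns, Finset.mem_singleton, funext_iff]
    simp [h]
  · rw [Finset.card_eq_zero.2, Nat.cast_zero]
    refine Finset.eq_empty_of_forall_notMem fun κ hκ => h ?_
    simpa using (mem_contentFns.1 hκ).2.symm

/-- Functions of a given content that are constant on `B` correspond to a color for `B` together
with a function on the rest. -/
lemma sum_contentFns_sdiff {M : Type*} [AddCommMonoid M] (w : V → ℕ+) {B S : Finset V} {v : V}
    (hv : v ∈ B) (hBS : B ⊆ S) (d : ℕ →₀ ℕ) (h : ℕ → (V → ℕ) → M) :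
    ∑ j ∈ d.support with (blockWeight w B : ℕ) ≤ d j,
      ∑ κ ∈ contentFns w (S \ B) (d - Finsupp.single j (blockWeight w B : ℕ)), h j κ =
    ∑ κ ∈ contentFns w S d with ∀ x ∈ B, κ x = κ v,
      h (κ v) (fun x => if x ∈ B then 0 else κ x) := by
  have hne : B.Nonempty := ⟨v, hv⟩
  rw [Finset.sum_sigma']
  -- One direction paints `B` with the color `j`; the other reads the color off at `v` and resets
  -- `B` to 0.
  refine Finset.sum_bij' (fun p _ x => if x ∈ B then p.1 else p.2 x)
    (fun κ _ => ⟨κ v, fun x => if x ∈ B then 0 else κ x⟩) ?_ ?_ ?_ ?_ ?_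
  · rintro ⟨j, κ⟩ hp
    simp only [Finset.mem_sigma, Finset.mem_filter, mem_contentFns] at hp ⊢
    obtain ⟨⟨_, hj⟩, hκ0, hκ⟩ := hp
    refine ⟨⟨fun x hx => ?_, ?_⟩, fun x hx => by simp [hx, hv]⟩
    · rw [if_neg fun hB => hx (hBS hB)]
      exact hκ0 x (by simp [hx])
    · rw [sum_single_split w hne hBS _ j fun x hx => if_pos hx,
        Finset.sum_congr rfl (g := fun v => Finsupp.single (κ v) (w v : ℕ)), hκ]
      -- Subtraction of exponents is truncated, so the bound on `d j` is needed to recover `d`.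
      · exact add_tsub_cancel_of_le (by simpa using hj)
      · intro x hx
        rw [if_neg (Finset.mem_sdiff.1 hx).2]
  · intro κ hκ
    simp only [Finset.mem_sigma, Finset.mem_filter, mem_contentFns] at hκ ⊢
    obtain ⟨⟨hκ0, hκ⟩, hconst⟩ := hκ
    have hsplit := sum_single_split w hne hBS κ (κ v) hconst
    rw [hκ] at hsplit
    refine ⟨⟨?_, ?_⟩, ?_, ?_⟩
    · simpa using apply_ne_zero_of_content hκ (hBS hv)
    · rw [hsplit]; simp
    · intro x hx
      split_ifs with hB
      · rfl
      · exact hκ0 x fun hS => hx (by simp [hS, hB])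
    · rw [hsplit, add_tsub_cancel_left]
      exact Finset.sum_congr rfl fun x hx => by rw [if_neg (Finset.mem_sdiff.1 hx).2]
  · rintro ⟨j, κ⟩ hp
    simp only [Finset.mem_sigma, Finset.mem_filter, mem_contentFns] at hp
    simp only [hv, if_true]
    congr 1
    funext x
    split_ifs with hB
    · exact (hp.2.1 x (by simp [hB])).symm
    · rfl
  · intro κ hκ
    simp only [Finset.mem_filter] at hκ
    funext x
    simp only
    split_ifs with hB
    · exact (hκ.2 x hB).symm
    · rfl
  · rintro ⟨j, κ⟩ hp
    simp only [Finset.mem_sigma, Finset.mem_filter, mem_contentFns] at hp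
    simp only [hv, if_true]
    congr 1
    funext x
    split_ifs with hB
    · exact hp.2.1 x (by simp [hB])
    · rfl

/-! ### The two block recursions -/

/-- Expansion of the chromatic symmetric function in power sums, one block at a time. -/
lemma csfOn_eq_sum_psum_mul (G : SimpleGraph V) (w : V → ℕ+) {S : Finset V} {v : V} (hv : v ∈ S) :
    csfOn K G w S = ∑ B ∈ S.powerset with v ∈ B,
      (blockCoeff G v B : K) • (psum (blockWeight w B) * csfOn K G w (S \ B)) := by
  apply Subtype.ext
  ext d
  have hL : ∀ (s : Finset (Finset V)) (f : Finset V → Lam K), MvPowerSeries.coeff d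
      (∑ B ∈ s, f B).1 = ∑ B ∈ s, MvPowerSeries.coeff d (f B).1 := fun s f =>
    map_sum ((MvPowerSeries.coeff d).comp (symAlg K).val.toLinearMap) f s
  have hterm : ∀ B ∈ S.powerset.filter (v ∈ ·), MvPowerSeries.coeff d
      ((blockCoeff G v B : K) • (psum (blockWeight w B) * csfOn K G w (S \ B))).1 =
      ∑ κ ∈ contentFns w S d, if (∀ x ∈ B, κ x = κ v) ∧ ProperOn G κ (S \ B) then
        (blockCoeff G v B : K) else 0 := by
    intro B hB
    rw [Finset.mem_filter, Finset.mem_powerset] at hB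
    change MvPowerSeries.coeff d
      ((blockCoeff G v B : K) • ((psum (blockWeight w B)).1 * (csfOn K G w (S \ B)).1)) = _
    rw [map_smul, coeff_psum_mul]
    simp only [coeff_csfOn]
    rw [sum_contentFns_sdiff w hB.2 hB.1 d (fun _ κ => if ProperOn G κ (S \ B) then (1 : K) else 0),
      Finset.sum_filter, smul_eq_mul, Finset.mul_sum]
    refine Finset.sum_congr rfl fun κ _ => ?_
    rw [ite_and, if_congr (properOn_congr (κ' := κ) fun x hx => if_neg (Finset.mem_sdiff.1 hx).2)
      rfl rfl]
    split_ifs <;> simp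
  rw [hL, Finset.sum_congr rfl hterm, Finset.sum_comm, coeff_csfOn]
  refine Finset.sum_congr rfl fun κ _ => ?_
  -- With `κ` fixed, the blocks that contribute are subsets of the color class `T` of `v`. If `κ` is
  -- proper off `T`, they are those in the recursion for `T`; otherwise there are none.
  set T := S.filter (κ · = κ v) with hT
  have h := congrArg (Int.cast (R := K)) (sum_blockCoeff G v T (by simp [hT, hv]))
  have h0 := properOn_iff_of_const G κ (S := S) (v := v) (Finset.empty_subset _)
  rw [Finset.sdiff_empty, Finset.sdiff_empty, ← hT] at h0
  rw [← Finset.sum_filter, Finset.filter_filter]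
  by_cases hP : ProperOn G κ (S \ T)
  · rw [if_congr (h0.trans (and_iff_right hP)) rfl rfl]
    rw [Int.cast_sum, Int.cast_ite, Int.cast_one, Int.cast_zero] at h
    rw [← h]
    refine Finset.sum_congr ?_ fun _ _ => rfl
    ext B
    simp only [Finset.mem_filter, Finset.mem_powerset]
    constructor
    · rintro ⟨hBT, hvB, hi⟩
      have hBS := hBT.trans (Finset.filter_subset _ _)
      exact ⟨hBS, hvB, fun x hx => (Finset.mem_filter.1 (hBT hx)).2,
        (properOn_iff_of_const G κ hBT).2 ⟨hP, hi⟩⟩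
    · rintro ⟨hBS, hvB, hc, hp⟩
      have hBT : B ⊆ T := fun x hx => Finset.mem_filter.2 ⟨hBS hx, hc x hx⟩
      exact ⟨hBT, hvB, ((properOn_iff_of_const G κ hBT).1 hp).2⟩
  · rw [if_neg fun h => hP (h0.1 h).1, Finset.sum_eq_zero]
    intro B hB
    simp only [Finset.mem_filter, Finset.mem_powerset] at hB
    have hBT : B ⊆ T := fun x hx => Finset.mem_filter.2 ⟨hB.1 hx, hB.2.2.1 x hx⟩
    exact absurd ((properOn_iff_of_const G κ hBT).1 hB.2.2.2).1 hP

variable [CharZero K]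

/-- The counterpart of `coeff_psum_mul` with `d j = n` in place of `n ≤ d j`: the new part never
merges with an old one. In the augmented basis the product is multiplication by a variable. Removing
a part `n` from the partition of `d` divides `multFact` by the multiplicity of `n`, which is the
number of indices `j` in the sum. -/
lemma coeff_augMonoT_mul (n : ℕ+) (f : Lam K) (d : ℕ →₀ ℕ) :
    MvPowerSeries.coeff d
        ((toLamT K).symm (augMonoT (Finsupp.single n 1) * toLamT K f)).1 =
      ∑ j ∈ d.support with d j = n,
        MvPowerSeries.coeff (d - Finsupp.single j (n : ℕ)) f.1 := by
  obtain ⟨x, rfl⟩ := augLin_bijective.2 f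
  have h1 : (toLamT K).symm (augMonoT (Finsupp.single n 1) * toLamT K (augLin K x)) =
      augLin K (MvPolynomial.X n * x) := by
    rw [← augAlgEquiv_monomial]
    exact congrArg (toLamT K).symm (map_mul (augAlgEquiv K) (MvPolynomial.X n) x).symm
  rw [h1, coeff_augLin, MvPolynomial.coeff_X_mul']
  set s := ptnOf d with hs
  have hterm : ∀ j ∈ d.support.filter fun j => d j = n,
      MvPowerSeries.coeff (d - Finsupp.single j (n : ℕ)) (augLin K x).1 =
        MvPolynomial.coeff (s - Finsupp.single n 1) x * (multFact (s - Finsupp.single n 1) : K) := by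
    intro j hj
    have hj' := (Finset.mem_filter.1 hj).2
    have h2 := ptnOf_tsub d j n hj'.ge
    rw [hj', Nat.sub_self, part_zero, add_zero, part_coe, ← hs] at h2
    rw [coeff_augLin, ← h2, add_tsub_cancel_right]
  have hcount : ((d.support.filter fun j => d j = n).card : K) = (s n : K) := by
    rw [Finset.card_filter, Nat.cast_sum]
    have h3 := sum_parts (K := K) d fun a => if a = n then 1 else 0
    push_cast
    rw [h3, ← hs, Finsupp.sum]
    simp only [PNat.coe_inj, mul_ite, mul_one, mul_zero, Finset.sum_ite_eq',
      Finsupp.mem_support_iff]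
    split_ifs with h0
    · rfl
    · rw [not_not.1 h0, Nat.cast_zero]
  rw [Finset.sum_congr rfl hterm, Finset.sum_const, nsmul_eq_mul, hcount]
  split_ifs with hn
  · have h4 : s - Finsupp.single n 1 + Finsupp.single n 1 = s :=
      tsub_add_cancel_of_le (by
        simpa using Nat.one_le_iff_ne_zero.2 (Finsupp.mem_support_iff.1 hn))
    have h5 := multFact_add_single (s - Finsupp.single n 1) n
    have h6 : (s - Finsupp.single n 1 : Ptn) n + 1 = s n := by
      have := DFunLike.congr_fun h4 n
      simpa using this
    rw [h4, h6] at h5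
    rw [h5]
    push_cast
    ring
  · rw [Finsupp.notMem_support_iff.1 hn]
    simp

/-- Expansion of the chromatic symmetric function in augmented monomial symmetric functions, one
color class at a time. -/
lemma csfOn_eq_sum_augMonoT_mul (G : SimpleGraph V) (w : V → ℕ+) {S : Finset V} {v : V}
    (hv : v ∈ S) :
    toLamT K (csfOn K G w S) = ∑ B ∈ S.powerset.filter fun B : Finset V => v ∈ B ∧ G.IsIndepSet (B : Set V),
      augMonoT (Finsupp.single (blockWeight w B) 1) * toLamT K (csfOn K G w (S \ B)) := by
  rw [← LinearEquiv.eq_symm_apply]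
  apply Subtype.ext
  ext d
  have hL : ∀ (s : Finset (Finset V)) (f : Finset V → LamT K), MvPowerSeries.coeff d
      ((toLamT K).symm (∑ B ∈ s, f B)).1 =
        ∑ B ∈ s, MvPowerSeries.coeff d ((toLamT K).symm (f B)).1 := fun s f =>
    map_sum (((MvPowerSeries.coeff d).comp (symAlg K).val.toLinearMap).comp
      (toLamT K).symm.toLinearMap) f s
  have hterm : ∀ B ∈ S.powerset.filter fun B : Finset V => v ∈ B ∧ G.IsIndepSet (B : Set V),
      MvPowerSeries.coeff d ((toLamT K).symm (augMonoT (Finsupp.single (blockWeight w B) 1) *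
        toLamT K (csfOn K G w (S \ B)))).1 =
      -- A coloring is counted for exactly one block, the full color class of `v`.
      ∑ κ ∈ contentFns w S d, if B = S.filter (κ · = κ v) ∧ ProperOn G κ S then 1 else 0 := by
    intro B hB
    rw [Finset.mem_filter, Finset.mem_powerset] at hB
    obtain ⟨hBS, hvB, hBi⟩ := hB
    rw [coeff_augMonoT_mul]
    simp only [coeff_csfOn]
    -- The equality is recast as a condition under the inequality, so that `sum_contentFns_sdiff`
    -- applies.
    have hle : d.support.filter (fun j => d j = (blockWeight w B : ℕ)) =
        (d.support.filter fun j => (blockWeight w B : ℕ) ≤ d j).filter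
          fun j => d j = (blockWeight w B : ℕ) := by
      rw [Finset.filter_filter]
      exact Finset.filter_congr fun j _ => ⟨fun h => ⟨h.ge, h⟩, And.right⟩
    rw [hle, Finset.sum_filter, Finset.sum_congr rfl (g := fun j =>
      ∑ κ ∈ contentFns w (S \ B) (d - Finsupp.single j (blockWeight w B : ℕ)),
        if d j = (blockWeight w B : ℕ) ∧ ProperOn G κ (S \ B) then (1 : K) else 0)
      (fun j _ => by split_ifs with h <;> simp [h]),
      sum_contentFns_sdiff w hvB hBS d
        (fun j κ => if d j = (blockWeight w B : ℕ) ∧ ProperOn G κ (S \ B) then (1 : K) else 0),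
      Finset.sum_filter]
    refine Finset.sum_congr rfl fun κ hκ => ?_
    rw [mem_contentFns] at hκ
    rw [if_congr (and_congr_right fun _ => properOn_congr (κ' := κ)
      fun x hx => if_neg (Finset.mem_sdiff.1 hx).2) rfl rfl, ← ite_and]
    refine if_congr ?_ rfl rfl
    set T := S.filter (κ · = κ v) with hT
    constructor
    · rintro ⟨hc, hd, hp⟩
      have hBT : B ⊆ T := fun x hx => Finset.mem_filter.2 ⟨hBS hx, hc x hx⟩
      have hsplit := sum_single_split w ⟨v, hvB⟩ hBS κ (κ v) hc
      -- The block already uses up the whole exponent of its color, so another vertex of that color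
      -- would add a positive weight beyond it.
      have hTB : T ⊆ B := by
        intro x hx
        by_contra hxB
        rw [Finset.mem_filter] at hx
        have h1 := apply_ne_zero_of_content (w := w) (S := S \ B) (κ := κ) rfl
          (Finset.mem_sdiff.2 ⟨hx.1, hxB⟩)
        have h2 := DFunLike.congr_fun hsplit (κ v)
        rw [hκ.2, Finsupp.add_apply, Finsupp.single_eq_same, hd, hx.2.symm] at h2
        exact h1 (by omega)
      have hBT' := hBT.antisymm hTB
      refine ⟨hBT', ?_⟩
      have h3 := properOn_iff_of_const G κ (S := S) (v := v) (Finset.empty_subset _)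
      rw [Finset.sdiff_empty, Finset.sdiff_empty, ← hT, ← hBT'] at h3
      exact h3.2 ⟨hp, hBi⟩
    · rintro ⟨rfl, hp⟩
      have hc : ∀ x ∈ T, κ x = κ v := fun x hx => (Finset.mem_filter.1 hx).2
      refine ⟨hc, ?_, fun x hx y hy => hp x (Finset.mem_sdiff.1 hx).1 y (Finset.mem_sdiff.1 hy).1⟩
      have h2 := DFunLike.congr_fun (sum_single_split w ⟨v, hvB⟩ hBS κ (κ v) hc) (κ v)
      rw [hκ.2, Finsupp.add_apply, Finsupp.single_eq_same, Finsupp.finsetSum_apply,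
        Finset.sum_eq_zero, add_zero] at h2
      · exact h2
      · intro x hx
        rw [Finset.mem_sdiff, Finset.mem_filter] at hx
        exact Finsupp.single_eq_of_ne fun h => hx.2 ⟨hx.1, h.symm⟩
  rw [hL, Finset.sum_congr rfl hterm, Finset.sum_comm, coeff_csfOn]
  refine Finset.sum_congr rfl fun κ _ => ?_
  by_cases hP : ProperOn G κ S
  · simp only [hP, and_true, if_true]
    rw [Finset.sum_ite_eq', if_pos]
    refine Finset.mem_filter.2 ⟨Finset.mem_powerset.2 (Finset.filter_subset _ _), by simp [hv], ?_⟩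
    have h3 := properOn_iff_of_const G κ (S := S) (v := v) (Finset.empty_subset _)
    rw [Finset.sdiff_empty, Finset.sdiff_empty] at h3
    exact (h3.1 hP).2
  · simp [hP]

end

/-! ### Homogeneity of products of power sums -/

section
variable {K : Type*} [Field K]

lemma one_mem_homog : (1 : Lam K) ∈ homog K 0 := by
  intro d hd
  change MvPowerSeries.coeff d 1 ≠ 0 at hd
  rw [MvPowerSeries.coeff_one] at hd
  have : d = 0 := by by_contra h; simp [h] at hd
  simp [this]

lemma mul_mem_homog {m n : ℕ} {f g : Lam K} (hf : f ∈ homog K m) (hg : g ∈ homog K n) :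
    f * g ∈ homog K (m + n) := by
  intro d hd
  change MvPowerSeries.coeff d (f.1 * g.1) ≠ 0 at hd
  rw [MvPowerSeries.coeff_mul] at hd
  obtain ⟨p, hp, hne⟩ := Finset.exists_ne_zero_of_sum_ne_zero hd
  rw [Finset.HasAntidiagonal.mem_antidiagonal] at hp
  rw [← hp, map_add, hf _ (left_ne_zero_of_mul hne), hg _ (right_ne_zero_of_mul hne)]

lemma psum_mem_homog (n : ℕ+) : (psum n : Lam K) ∈ homog K n := by
  intro d hd
  rw [coeff_psum] at hd
  obtain ⟨j, rfl⟩ : ∃ j : ℕ, d = Finsupp.single j (n : ℕ) := by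
    by_contra h
    simp [h] at hd
  simp

lemma mono_mem_homog (r : Ptn) : (mono r : Lam K) ∈ homog K (wt r) := by
  intro d hd
  rw [coeff_mono] at hd
  have : ptnOf d = r := by by_contra h; simp [h] at hd
  rw [← this, wt_ptnOf]

lemma prod_pow_mem_homog (r : Ptn) :
    (r.prod fun n k => (psum n : Lam K) ^ k) ∈ homog K (wt r) := by
  induction r using Finsupp.induction_linear with
  | zero => simpa using one_mem_homog
  | add r s hr hs =>
    rw [Finsupp.prod_add_index' (by simp) (fun _ _ _ => pow_add _ _ _), map_add]
    exact mul_mem_homog hr hs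
  | single n k =>
    rw [Finsupp.prod_single_index (h := fun n k => (psum n : Lam K) ^ k) (pow_zero _), wt_single]
    induction k with
    | zero => simpa using one_mem_homog
    | succ k ih =>
      rw [pow_succ, Nat.succ_mul]
      exact mul_mem_homog ih (psum_mem_homog n)

lemma psumHom_eq_sum (x : Poly K) :
    psumHom K x = ∑ r ∈ x.support, x.coeff r • r.prod fun n k => (psum n : Lam K) ^ k := by
  conv_lhs => rw [MvPolynomial.as_sum x, map_sum]
  refine Finset.sum_congr rfl fun r _ => ?_
  rw [psumHom, MvPolynomial.aeval_monomial, Algebra.smul_def]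

end

/-! ### Morphisms scaling the power sums, and complementation -/

section
variable {K : Type*} [Field K] [CharZero K]

/-- The algebra map `Λ → Λ̃` with `p_n ↦ a n • m̃_n`. -/
def scaleHom (a : ℕ+ → K) : Lam K →ₐ[K] LamT K :=
  (MvPolynomial.aeval fun n => a n • augMonoT (Finsupp.single n 1)).comp
    (psumEquiv K).symm.toAlgHom

lemma scaleHom_psum (a : ℕ+ → K) (n : ℕ+) :
    scaleHom a (psum n) = a n • augMonoT (Finsupp.single n 1) := by simp [scaleHom]

/-- The Hopf algebra morphism `Λ → Λ̃` with `p_n ↦ a n • m̃_n`. -/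
def scaleBialgHom (a : ℕ+ → K) : Lam K →ₐc[K] LamT K :=
  BialgHom.ofAlgHom (scaleHom a)
    (algHom_ext fun n => by
      have h : Coalgebra.counit (R := K) (psum n : Lam K) = 0 := constTerm_psum n
      simp [scaleHom_psum, counit_augMonoT, h])
    -- It suffices to compare on generators, where a multiple of a primitive element is primitive.
    (algHom_ext fun n => by
      simp [scaleHom_psum, comul_psum, comul_augMonoT, TensorProduct.smul_tmul', smul_add])

lemma scaleBialgHom_apply (a : ℕ+ → K) (f : Lam K) : scaleBialgHom a f = scaleHom a f := rfl

lemma augMonoT_mem_homogT (r : Ptn) : (augMonoT r : LamT K) ∈ homogT K (wt r) :=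
  Submodule.mem_map_of_mem (Submodule.smul_mem _ _ (mono_mem_homog r))

/-- The ⊙-product of the m̃_n over the parts of `r` is m̃_r, so the morphism is diagonal between the
two bases; preservation of degree rests on this. -/
lemma scaleHom_prod_pow (a : ℕ+ → K) (r : Ptn) :
    scaleHom a (r.prod fun n k => (psum n : Lam K) ^ k) =
      (r.prod fun n k => a n ^ k) • augMonoT r := by
  have h : (r.prod fun n k => (augMonoT (Finsupp.single n 1) : LamT K) ^ k) = augMonoT r := by
    have h1 := congrArg (augAlgEquiv K) (MvPolynomial.monomial_eq (s := r) (a := (1 : K)))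
    rw [augAlgEquiv_monomial, map_one, one_mul, map_finsuppProd] at h1
    rw [h1]
    refine Finsupp.prod_congr fun n _ => ?_
    rw [map_pow, ← augAlgEquiv_monomial]; rfl
  rw [map_finsuppProd, ← h, Finsupp.prod, Finsupp.prod, Finsupp.prod, ← Finset.prod_smul]
  exact Finset.prod_congr rfl fun n _ => by rw [map_pow, scaleHom_psum, smul_pow]

lemma scaleHom_mem_homogT (a : ℕ+ → K) {d : ℕ} {f : Lam K} (hf : f ∈ homog K d) :
    scaleHom a f ∈ homogT K d := by
  obtain ⟨x, rfl⟩ := psumHom_bijective.2 f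
  let P : Ptn → Lam K := fun r => x.coeff r • r.prod fun n k => (psum n : Lam K) ^ k
  have hP : ∀ r, P r ∈ homog K (wt r) := fun r => Submodule.smul_mem _ _ (prod_pow_mem_homog r)
  -- A homogeneous element equals the sum of its power sum terms of the right weight, as comparing
  -- coefficients degree by degree shows.
  have hx : psumHom K x = ∑ r ∈ x.support with wt r = d, P r := by
    apply Subtype.ext
    ext e
    have hL : ∀ s : Finset Ptn, MvPowerSeries.coeff e (∑ r ∈ s, P r).1 =
        ∑ r ∈ s, MvPowerSeries.coeff e (P r).1 := fun s =>
      map_sum ((MvPowerSeries.coeff e).comp (symAlg K).val.toLinearMap) P s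
    rw [hL, Finset.sum_filter]
    by_cases he : e.degree = d
    · rw [psumHom_eq_sum, hL]
      refine Finset.sum_congr rfl fun r _ => ?_
      split_ifs with hr
      · rfl
      · by_contra h
        exact hr ((hP r e h).symm.trans he)
    · rw [Finset.sum_eq_zero]
      · by_contra h
        exact he (hf e h)
      · intro r _
        split_ifs with hr
        · by_contra h
          exact he ((hP r e h).trans hr)
        · rfl
  rw [hx, map_sum]
  refine Submodule.sum_mem _ fun r hr => ?_
  rw [map_smul, scaleHom_prod_pow, ← (Finset.mem_filter.1 hr).2]
  exact Submodule.smul_mem _ _ (Submodule.smul_mem _ _ (augMonoT_mem_homogT r))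

/-- If `a` inverts the block coefficients of the cliques and vanishes on the weights of the other
connected sets, then the associated morphism complements the graph. -/
lemma scaleHom_csfOn {V : Type*} [Fintype V] (G : SimpleGraph V) (w : V → ℕ+) (a : ℕ+ → K)
    (hclique : ∀ (k : ℕ) (s : Finset V) (hs : s.Nonempty), G.IsNClique (k + 1) s →
      a (setWeight w s hs) = (-1) ^ k / (k ! : K))
    (hconn : ∀ (s : Finset V) (hs : s.Nonempty), (G.induce (s : Set V)).Connected →
      ¬ G.IsClique (s : Set V) → a (setWeight w s hs) = 0) (S : Finset V) :
    scaleHom a (csfOn K G w S) = toLamT K (csfOn K Gᶜ w S) := by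
  obtain ⟨H, hH⟩ : ∃ H, H = Gᶜ := ⟨_, rfl⟩
  rw [← hH]
  induction S using Finset.strongInduction with
  | H S ih =>
    rcases S.eq_empty_or_nonempty with rfl | ⟨v, hv⟩
    · rw [csfOn_empty, csfOn_empty, map_one, ← augLin_one]; rfl
    rw [csfOn_eq_sum_psum_mul G w hv, csfOn_eq_sum_augMonoT_mul H w hv, map_sum,
      ← Finset.filter_filter]
    -- Independence in the complement becomes an indicator, so that both recursions run over the
    -- same blocks.
    refine Eq.trans ?_ (Finset.sum_filter _ _).symm
    refine Finset.sum_congr rfl fun B hB => ?_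
    rw [Finset.mem_filter, Finset.mem_powerset] at hB
    have hne : B.Nonempty := ⟨v, hB.2⟩
    -- For a clique the two factors are inverse to each other. For a connected block that is not a
    -- clique the scalar vanishes; for a disconnected one the block coefficient does, whatever the
    -- scalar is.
    have hcoeff : (blockCoeff G v B : K) * a (blockWeight w B) =
        if H.IsIndepSet (B : Set V) then 1 else 0 := by
      rw [blockWeight_of_nonempty w hne]
      split_ifs with hc
      · rw [hH, SimpleGraph.isIndepSet_compl] at hc
        have hcard : B.card = (B.card - 1) + 1 := (Nat.sub_add_cancel hne.card_pos).symm
        have hn : G.IsNClique (B.card - 1 + 1) B := ⟨hc, hcard⟩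
        rw [blockCoeff_clique G v _ B hB.2 hn, hclique _ B hne hn]
        have : (((B.card - 1)! : ℕ) : K) ≠ 0 := by exact_mod_cast Nat.factorial_ne_zero _
        push_cast
        rw [mul_div_assoc', mul_right_comm, mul_div_assoc, div_self this, mul_one, ← mul_pow]
        simp
      · rw [hH, SimpleGraph.isIndepSet_compl] at hc
        by_cases hcn : (G.induce (B : Set V)).Connected
        · rw [hconn B hne hcn hc, mul_zero]
        · rw [blockCoeff_eq_zero_of_not_connected G v B hB.2 hcn, Int.cast_zero, zero_mul]
    rw [map_smul, map_mul, scaleHom_psum, ih _ (Finset.sdiff_ssubset hB.1 hne), smul_mul_assoc,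
      smul_smul, hcoeff, ite_smul, one_smul, zero_smul]

end

end SymFunc

end

/-! ### Choice of the scaling -/

theorem proposition1p9 {K : Type*} [Field K] [CharZero K]
    (Cstar : Set ℕ+) (C : ℕ+ → Set ℕ+)
    (hstar : ∀ k : ℕ+, Disjoint Cstar (C k))
    (hC : ∀ k l : ℕ+, k ≠ l → Disjoint (C k) (C l)) :
    ∃ φ : SymFunc.Lam K →ₐc[K] SymFunc.LamT K,
      (∀ (d : ℕ), ∀ f ∈ SymFunc.homog K d, φ f ∈ SymFunc.homogT K d) ∧
      (∀ (k : ℕ+), ∀ n ∈ C k, φ (SymFunc.psum n) =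
        ((-1 : K) ^ ((k : ℕ) - 1) / (Nat.factorial ((k : ℕ) - 1) : K)) •
          SymFunc.augMonoT (Finsupp.single n 1)) ∧
      (∀ n ∈ Cstar, φ (SymFunc.psum n) = 0) ∧
      ∀ (V : Type*) [Fintype V] (G : SimpleGraph V) (w : V → ℕ+),
        (∀ (k : ℕ+) (s : Finset V) (hs : s.Nonempty), G.IsNClique k s →
          SymFunc.setWeight w s hs ∈ C k) →
        (∀ (s : Finset V) (hs : s.Nonempty), (G.induce (s : Set V)).Connected →
          ¬ G.IsClique (s : Set V) → SymFunc.setWeight w s hs ∈ Cstar) →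
        φ (SymFunc.csf K G w) = SymFunc.toLamT K (SymFunc.csf K Gᶜ w) := by
  classical
  -- The scaling depends only on the sets `C k`, so one morphism serves all graphs. The default 0 is
  -- the value required on `Cstar`; on weights in none of the sets it is arbitrary.
  let a : ℕ+ → K := fun n => if h : ∃ k, n ∈ C k then
    (-1) ^ ((h.choose : ℕ) - 1) / (Nat.factorial ((h.choose : ℕ) - 1) : K) else 0
  have haC : ∀ k : ℕ+, ∀ n ∈ C k,
      a n = (-1) ^ ((k : ℕ) - 1) / (Nat.factorial ((k : ℕ) - 1) : K) := by
    intro k n hn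
    have h : ∃ k, n ∈ C k := ⟨k, hn⟩
    -- Disjointness of the sets `C k` makes the chosen index the only possible one.
    have hk : h.choose = k := by
      by_contra hne
      exact Set.disjoint_left.1 (hC _ _ hne) h.choose_spec hn
    simp only [a, dif_pos h, hk]
  have hastar : ∀ n ∈ Cstar, a n = 0 := fun n hn =>
    dif_neg fun ⟨k, hk⟩ => Set.disjoint_left.1 (hstar k) hn hk
  refine ⟨SymFunc.scaleBialgHom a, fun d f hf => SymFunc.scaleHom_mem_homogT a hf,
    fun k n hn => ?_, fun n hn => ?_, fun V _ G w h1 h2 => ?_⟩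
  · rw [SymFunc.scaleBialgHom_apply, SymFunc.scaleHom_psum, haC k n hn]
  · rw [SymFunc.scaleBialgHom_apply, SymFunc.scaleHom_psum, hastar n hn, zero_smul]
  · rw [SymFunc.scaleBialgHom_apply, ← SymFunc.csfOn_univ, ← SymFunc.csfOn_univ]
    refine SymFunc.scaleHom_csfOn G w a (fun k s hs hk => ?_)
      (fun s hs hc hn => hastar _ (h2 s hs hc hn)) _
    -- `scaleHom_csfOn` indexes a clique by its size minus one.
    exact haC k.succPNat _ (h1 k.succPNat s hs hk)
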